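/- Let $f:\mathbb R^m\to\mathbb R$ be convex and $l_f$-Lipschitz, let $h:\mathbb R^n\to\mathbb R\cup\{+\infty\}$ be closed, convex and proper, and let $g(x)=\mathbb E_{\xi\sim D}[g_\xi(x)]$ with $g_\xi:\mathbb R^n\to\mathbb R^m$ differentiable, where $g$ is differentiable and $l_g$-Lipschitz and its Jacobian $g'$ is $L_g$-Lipschitz in operator norm ($m+n\ge1$). Put $\Phi=f\circ g+h$ and assume $\Phi^*=\inf\Phi>-\infty$. Assume that for (almost) every $\xi\sim D$ and all $x$, $\|g_\xi(x)-g(x)\|_2\le\sigma_g$ and $\|g_\xi'(x)-g'(x)\|_{\rm op}\le\sigma_{g'}$. Let $M>5l_fL_g$, and let $\mathcal G_M(x)=M(x-x_+)$ with $x_+=\operatorname{argmin}_y\{f(g(x)+g'(x)(y-x))+h(y)+\frac M2\|y-x\|_2^2\}$. Mini-batch prox-linear method: from $x_0^0$ with $\Phi(x_0^0)<\infty$, for $k=0,\dots,K-1$ and $i=0,\dots,\tau_k-1$ draw fresh independent samples $\mathcal A_i^k$ and $\mathcal B_i^k$ from $D$, of sizes $A$ and $B$; set $\widetilde g_i^k=\frac1A\sum_{\xi\in\mathcal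 A_i^k}g_\xi(x_i^k)$, $\widetilde J_i^k=\frac1B\sum_{\xi\in\mathcal B_i^k}g'_\xi(x_i^k)$ and $s_i^k(y)=f(\widetilde g_i^k+\widetilde J_i^k(y-x_i^k))+h(y)+\frac M2\|y-x_i^k\|_2^2$; let $x_{i+1}^k=\mathtt{solver}(s_i^k,\overline\epsilon,\overline\delta)$; and after each epoch put $x_0^{k+1}=x_{\tau_k}^k$. Here $\mathtt{solver}$ is a randomized procedure, with fresh independent randomness in each call, that for all $\overline\epsilon,\overline\delta>0$ and every such model $s$ returns, with probability at least $1-\overline\delta$, a point $x_{\rm sol}$ with $s(x_{\rm sol})\le\inf s+\overline\epsilon$. Let $\Sigma_\tau=\sum_{k<K}\tau_k$ with all $\tau_k\ge1$. There are constants $C_\Sigma,C_A,C_B,\epsilon_0>0$, depending only on $M,l_f,L_g,\sigma_g,\sigma_{g'}$ and (an upper bound for) $\Phi(x_0^0)-\Phi^*$, such that the following holds for all $\Delta\in(0,1)$ and $\epsilon\in(0,\epsilon_0]$. If $\Sigma_\tau=\lceil C_\Sigma\epsilon^{-1}\rceil$, $A=\lceil C_A\epsilon^{-2}\log(4(m+1)\Sigma_\tau/\Delta)\rceil$,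 $B=\lceil C_B\epsilon^{-1}\log(4(m+n)\Sigma_\tau/\Delta)\rceil$, $0<\overline\delta\le\Delta/(2\Sigma_\tau)$ and $0<\overline\epsilon\le\epsilon/(5\cdot30M)$, then with probability at least $1-\Delta$: (i) $\frac1{\Sigma_\tau}\sum_{k=0}^{K-1}\sum_{i=0}^{\tau_k-1}\|\mathcal G_M(x_i^k)\|_2^2\le\epsilon$, and (ii) the numbers $N_g$ and $N_{g'}$ of evaluations of $g_\xi$ and of $g'_\xi$ are $\widetilde\Theta(\epsilon^{-3}\log(1/\Delta))$ and $\widetilde\Theta(\epsilon^{-2}\log(1/\Delta))$, in this sense: for every $\Delta_0\in(0,1)$ there are $c,C>0$, depending only on $\Delta_0,m,n$ and the quantities above, with $c\,\epsilon^{-3}\log\frac1\Delta\le N_g\le C\,\epsilon^{-3}\log\frac1\epsilon\,\log\frac1\Delta$ and $c\,\epsilon^{-2}\log\frac1\Delta\le N_{g'}\le C\,\epsilon^{-2}\log\frac1\epsilon\,\log\frac1\Delta$ whenever $\Delta\le\Delta_0$. -/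

import Mathlib

open MeasureTheory
open scoped NNReal

noncomputable section

/-- The Euclidean space `ℝᵈ` (with the 2-norm). Continuous linear maps `Vec n →L[ℝ] Vec m`, with
their operator norm, play the role of `m × n` matrices with the spectral norm. -/
abbrev Vec (d : ℕ) : Type := EuclideanSpace ℝ (Fin d)

/-! ### The composite problem `min f (g x) + h x` with `g x = E[g_ξ x]` -/

/-- The data of a composite stochastic problem: the outer function `f`, the extended-valued
regularizer `h`, the components `G ξ = g_ξ` and the sampling distribution `D` of `ξ`. -/
structure Problem (n m : ℕ) (Ξ : Type*) [MeasurableSpace Ξ] where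
  f : Vec m → ℝ
  h : Vec n → EReal
  G : Ξ → Vec n → Vec m
  D : Measure Ξ

namespace Problem

variable {n m : ℕ} {Ξ : Type*} [MeasurableSpace Ξ]

/-- `g x = E_{ξ ∼ D} [g_ξ x]`. -/
def g (P : Problem n m Ξ) (x : Vec n) : Vec m := ∫ ξ, P.G ξ x ∂P.D

/-- The Jacobian `g' x`. -/
def jac (P : Problem n m Ξ) (x : Vec n) : Vec n →L[ℝ] Vec m := fderiv ℝ P.g x

/-- The objective `Φ = f ∘ g + h`. -/
def Φ (P : Problem n m Ξ) (x : Vec n) : EReal := (P.f (P.g x) : EReal) + P.h x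

/-- The proximal model `y ↦ f (u + J (y - x)) + h y + (M / 2) ‖y - x‖²`. -/
def model (P : Problem n m Ξ) (M : ℝ) (u : Vec m) (J : Vec n →L[ℝ] Vec m) (x : Vec n) :
    Vec n → EReal :=
  fun y => (P.f (u + J (y - x)) : EReal) + P.h y + ((M / 2 * ‖y - x‖ ^ 2 : ℝ) : EReal)

/-- The exact prox-linear step from `x`: the minimizer of the model built from `g x` and `g' x`.
(It exists and is unique for `M > 0` under the standing assumptions below.) -/
def proxStep (P : Problem n m Ξ) (M : ℝ) (x : Vec n) : Vec n :=
  Classical.epsilon fun y => ∀ z, P.model M (P.g x) (P.jac x) x y ≤ P.model M (P.g x) (P.jac x) x z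

/-- The generalized gradient `𝒢_M x = M (x - x₊)`. -/
def genGrad (P : Problem n m Ξ) (M : ℝ) (x : Vec n) : Vec n := M • (x - P.proxStep M x)

/-- The standing assumptions: `f` is convex and `lf`-Lipschitz; `g` is the expectation of the
differentiable random components, is differentiable and `lg`-Lipschitz, and has an `Lg`-Lipschitz
Jacobian in operator norm; `h` is closed, convex and proper with values in `ℝ ∪ {+∞}`. -/
structure Standing (P : Problem n m Ξ) (lf lg Lg : ℝ≥0) : Prop where
  convex_f : ConvexOn ℝ Set.univ P.f
  lipschitz_f : LipschitzWith lf P.f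
  measurable_G : ∀ x, Measurable fun ξ => P.G ξ x
  integrable_G : ∀ x, Integrable (fun ξ => P.G ξ x) P.D
  differentiable_G : ∀ ξ, Differentiable ℝ (P.G ξ)
  differentiable_g : Differentiable ℝ P.g
  lipschitz_g : LipschitzWith lg P.g
  lipschitz_jac : LipschitzWith Lg P.jac
  closed_h : LowerSemicontinuous P.h
  convex_h : Convex ℝ {p : Vec n × ℝ | P.h p.1 ≤ (p.2 : EReal)}
  ne_bot_h : ∀ x, P.h x ≠ ⊥
  proper_h : ∃ x, P.h x ≠ ⊤

/-- Uniform variance-like bounds for the components and their Jacobians, for (almost) every `ξ`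
drawn from `D` and every point. -/
def UniformVariance (P : Problem n m Ξ) (σg σJ : ℝ) : Prop :=
  ∀ᵐ ξ ∂P.D, ∀ x, ‖P.G ξ x - P.g x‖ ≤ σg ∧ ‖fderiv ℝ (P.G ξ) x - P.jac x‖ ≤ σJ

end Problem

/-! ### Oracle programs that count evaluations of `g_ξ` and of `g'_ξ` -/

/-- The result of a computation together with the number of evaluations of components `g_ξ`
and of Jacobians `g'_ξ` made by it. -/
structure Counted (α : Type*) where
  val : α
  gEvals : ℕ
  jacEvals : ℕ

namespace Counted

/-- An oracle-free computation. -/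
def pure {α : Type*} (a : α) : Counted α := ⟨a, 0, 0⟩

/-- Sequential composition; the counters add up. -/
def bind {α β : Type*} (a : Counted α) (k : α → Counted β) : Counted β :=
  ⟨(k a.val).val, a.gEvals + (k a.val).gEvals, a.jacEvals + (k a.val).jacEvals⟩

/-- The average of the results of `N` computations; the counters add up. -/
def mean {N : ℕ} {V : Type*} [AddCommGroup V] [Module ℝ V] (p : Fin N → Counted V) : Counted V :=
  ⟨(N : ℝ)⁻¹ • ∑ r, (p r).val, ∑ r, (p r).gEvals, ∑ r, (p r).jacEvals⟩

end Counted

/-! ### The mini-batch prox-linear method -/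

/-- A (possibly randomized) solver: it receives an objective `s`, the tolerances `εbar`, `δbar`
and a random seed. -/
abbrev Solver (n : ℕ) (S : Type*) : Type _ := (Vec n → EReal) → ℝ → ℝ → S → Vec n

/-- The randomness of one iteration: the batch of size `A` for `g`, the batch of size `B`
for `g'`, and the seed of the solver. -/
abbrev Draw (Ξ S : Type*) (A B : ℕ) : Type _ := (Fin A → Ξ) × (Fin B → Ξ) × S

/-- All draws of one iteration are independent, samples with law `D` and the seed with law `ν`. -/
def drawLaw {Ξ S : Type*} [MeasurableSpace Ξ] [MeasurableSpace S] (D : Measure Ξ) (ν : Measure S)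
    (A B : ℕ) : Measure (Draw Ξ S A B) :=
  (Measure.pi fun _ => D).prod ((Measure.pi fun _ => D).prod ν)

/-- The law of the randomness of a run: independent identically distributed draws for the
iterations `(k, i)`. -/
def runLaw {Ξ S : Type*} [MeasurableSpace Ξ] [MeasurableSpace S] (D : Measure Ξ) (ν : Measure S)
    (A B : ℕ) : Measure (ℕ × ℕ → Draw Ξ S A B) :=
  Measure.infinitePi fun _ => drawLaw D ν A B

namespace Problem

variable {n m : ℕ} {Ξ S : Type*} [MeasurableSpace Ξ] [MeasurableSpace S]

/-- The solver depends measurably on the model and its seed, and for all tolerances and all models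
it returns an `εbar`-optimal solution with probability at least `1 - δbar`. -/
structure SolverAssumption (P : Problem n m Ξ) (M : ℝ) (ν : Measure S) (solver : Solver n S) :
    Prop where
  measurable : ∀ εbar δbar : ℝ, 0 < εbar → 0 < δbar →
    Measurable fun p : (Vec m × (Vec n →L[ℝ] Vec m) × Vec n) × S =>
      solver (P.model M p.1.1 p.1.2.1 p.1.2.2) εbar δbar p.2
  success : ∀ εbar δbar : ℝ, 0 < εbar → 0 < δbar → ∀ u J x,
    ENNReal.ofReal (1 - δbar) ≤
      ν {ζ | P.model M u J x (solver (P.model M u J x) εbar δbar ζ) ≤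
        (⨅ y, P.model M u J x y) + (εbar : EReal)}

/-- One oracle call for `g_ξ x`. -/
def evalG (P : Problem n m Ξ) (ξ : Ξ) (x : Vec n) : Counted (Vec m) := ⟨P.G ξ x, 1, 0⟩

/-- One oracle call for `g'_ξ x`. -/
def evalJac (P : Problem n m Ξ) (ξ : Ξ) (x : Vec n) : Counted (Vec n →L[ℝ] Vec m) :=
  ⟨fderiv ℝ (P.G ξ) x, 0, 1⟩

/-- The mini-batch estimator of `(g x, g' x)`. -/
def miniBatch (P : Problem n m Ξ) {A B : ℕ} (a : Fin A → Ξ) (b : Fin B → Ξ) (x : Vec n) :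
    Counted (Vec m × (Vec n →L[ℝ] Vec m)) :=
  (Counted.mean fun r => P.evalG (a r) x).bind fun u =>
    (Counted.mean fun r => P.evalJac (b r) x).bind fun J => Counted.pure (u, J)

/-- One iteration: estimate, then solve the resulting model inexactly. -/
def step (P : Problem n m Ξ) (M : ℝ) (solver : Solver n S) (εbar δbar : ℝ) {A B : ℕ}
    (w : Draw Ξ S A B) (x : Vec n) : Counted (Vec n) :=
  (P.miniBatch w.1 w.2.1 x).bind fun e =>
    Counted.pure (solver (P.model M e.1 e.2 x) εbar δbar w.2.2)

/-- The first `i` inner iterations of epoch `k`, continuing from `start`. -/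
def epoch (P : Problem n m Ξ) (M : ℝ) (solver : Solver n S) (εbar δbar : ℝ) {A B : ℕ}
    (ω : ℕ × ℕ → Draw Ξ S A B) (k : ℕ) (start : Counted (Vec n)) : ℕ → Counted (Vec n)
  | 0 => start
  | i + 1 => (P.epoch M solver εbar δbar ω k start i).bind
      (P.step M solver εbar δbar (ω (k, i)))

/-- The run up to the start of epoch `k`: its value is `x_0^k`, where `x_0^{k+1} = x_{τ_k}^k`, and
its counters are the numbers of oracle calls made in the epochs before `k`. -/
def run (P : Problem n m Ξ) (M : ℝ) (solver : Solver n S) (εbar δbar : ℝ) {A B : ℕ}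
    (ω : ℕ × ℕ → Draw Ξ S A B) (x₀ : Vec n) (τ : ℕ → ℕ) : ℕ → Counted (Vec n)
  | 0 => Counted.pure x₀
  | k + 1 => P.epoch M solver εbar δbar ω k (P.run M solver εbar δbar ω x₀ τ k) (τ k)

/-- The iterate `x_i^k`. -/
def iterate (P : Problem n m Ξ) (M : ℝ) (solver : Solver n S) (εbar δbar : ℝ) {A B : ℕ}
    (ω : ℕ × ℕ → Draw Ξ S A B) (x₀ : Vec n) (τ : ℕ → ℕ) (k i : ℕ) : Vec n :=
  (P.epoch M solver εbar δbar ω k (P.run M solver εbar δbar ω x₀ τ k) i).val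

end Problem

end

/-! ### Trace inequalities for symmetric operators -/

section TraceInequalities

variable {V : Type*} [NormedAddCommGroup V] [InnerProductSpace ℝ V]

/-! The argument joins a deterministic descent estimate to a matrix concentration bound.

Descent: since `M > 5 l_f L_g`, the linearization error of `f ∘ g` is dominated by the proximal
term. If the estimates of `g x` and `g' x` have errors at most `tg` and `tJ`, and the solver is
`εbar`-accurate, then one step decreases `Φ` by `‖𝒢_M x‖² / (8M)` up to an error `2 l_f tg + 3 l_f²
tJ² / M + εbar`. The Jacobian error is multiplied by a step length, so Young's inequality makes it
quadratic, whereas the value error stays linear. Hence `tg ~ ε` but `tJ ~ √ε`, which is what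
separates `A ~ ε⁻²` from `B ~ ε⁻¹`. Telescoping over about `1/ε` steps bounds the average.

Concentration: the norm of a mean of independent centred operators bounded by `σ` must have a tail
of the form `dim · exp(-p)` once the batch has order `p σ² / t²`. Self-adjoint dilation reduces this
to symmetric operators. For those the potential is `∑_{q ≤ p} tr X^(2q) / (2q)!`. Its second
derivative along a line `X + sY` is at most `(2σ)²` times itself, so adding `Y` multiplies it by at
most `cosh (2σ)` plus a term linear in `Y`. The linear term has mean zero. Induction over the batch
and Markov's inequality finish; even powers control both ends of the spectrum at once, and the
potential is a polynomial in the operator.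

Probability: an iterate depends only on earlier draws, so the tail bounds, uniform in the base
point, apply to the fresh draw by Fubini. A union bound over all iterations has total cost at most
`Δ`. The oracle counts are deterministic, so (ii) is arithmetic with logarithms. -/

theorem isSymmetric_pow {X : V →L[ℝ] V} (hX : (X : V →ₗ[ℝ] V).IsSymmetric) (k : ℕ) (v w : V) :
    inner ℝ ((X ^ k) v) w = inner ℝ v ((X ^ k) w) := by
  induction k generalizing v w with
  | zero => simp
  | succ k ih =>
    rw [pow_succ, mul_apply_eq_comp, ih]
    rw [← pow_succ, pow_succ', mul_apply_eq_comp]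
    exact hX v _

theorem isSymmetric_add_smul {X Y : V →L[ℝ] V} (hX : (X : V →ₗ[ℝ] V).IsSymmetric)
    (hY : (Y : V →ₗ[ℝ] V).IsSymmetric) (s : ℝ) :
    ((X + s • Y : V →L[ℝ] V) : V →ₗ[ℝ] V).IsSymmetric := by
  intro v w
  have h1 : inner ℝ (X v) w = inner ℝ v (X w) := hX v w
  have h2 : inner ℝ (Y v) w = inner ℝ v (Y w) := hY v w
  simp [inner_add_left, inner_add_right, inner_smul_left, inner_smul_right, h1, h2]

variable [FiniteDimensional ℝ V]

/-- The trace as a continuous linear functional on endomorphisms. -/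
noncomputable def traceCLM (V : Type*) [NormedAddCommGroup V] [InnerProductSpace ℝ V]
    [FiniteDimensional ℝ V] : (V →L[ℝ] V) →L[ℝ] ℝ :=
  LinearMap.toContinuousLinearMap ((LinearMap.trace ℝ V).comp (ContinuousLinearMap.coeLM ℝ))

theorem traceCLM_apply (T : V →L[ℝ] V) : traceCLM V T = LinearMap.trace ℝ V (T : V →ₗ[ℝ] V) := rfl

theorem traceCLM_eq_sum_inner {ι : Type*} [Fintype ι] (b : OrthonormalBasis ι ℝ V)
    (T : V →L[ℝ] V) : traceCLM V T = ∑ i, inner ℝ (b i) (T (b i)) := by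
  rw [traceCLM_apply, LinearMap.trace_eq_sum_inner _ b]
  rfl

theorem traceCLM_mul_comm (S T : V →L[ℝ] V) : traceCLM V (S * T) = traceCLM V (T * S) := by
  rw [traceCLM_apply, traceCLM_apply]
  exact LinearMap.trace_mul_comm ℝ (S : V →ₗ[ℝ] V) (T : V →ₗ[ℝ] V)

theorem exists_eigenbasis {X : V →L[ℝ] V} (hX : (X : V →ₗ[ℝ] V).IsSymmetric) :
    ∃ (b : OrthonormalBasis (Fin (Module.finrank ℝ V)) ℝ V) (l : Fin (Module.finrank ℝ V) → ℝ),
      ∀ (k : ℕ) (i), (X ^ k) (b i) = l i ^ k • b i := by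
  refine ⟨hX.eigenvectorBasis rfl, hX.eigenvalues rfl, fun k i => ?_⟩
  have h1 : X (hX.eigenvectorBasis rfl i) =
      hX.eigenvalues rfl i • hX.eigenvectorBasis rfl i := hX.apply_eigenvectorBasis rfl i
  induction k with
  | zero => simp
  | succ k ih =>
    rw [pow_succ, mul_apply_eq_comp, h1, map_smul, ih, smul_smul, pow_succ']

theorem traceCLM_pow_eq_sum {X : V →L[ℝ] V} {ι : Type*} [Fintype ι] {b : OrthonormalBasis ι ℝ V}
    {l : ι → ℝ} (hb : ∀ (k : ℕ) (i), (X ^ k) (b i) = l i ^ k • b i) (k : ℕ) :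
    traceCLM V (X ^ k) = ∑ i, l i ^ k := by
  rw [traceCLM_eq_sum_inner b]
  refine Finset.sum_congr rfl fun i _ => ?_
  rw [hb, inner_smul_right, real_inner_self_eq_norm_sq, b.norm_eq_one]
  simp

theorem traceCLM_even_pow_nonneg {X : V →L[ℝ] V} (hX : (X : V →ₗ[ℝ] V).IsSymmetric) (q : ℕ) :
    0 ≤ traceCLM V (X ^ (2 * q)) := by
  obtain ⟨b, l, hb⟩ := exists_eigenbasis hX
  rw [traceCLM_pow_eq_sum hb]
  exact Finset.sum_nonneg fun i _ => (even_two_mul q).pow_nonneg _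

/-- Each `λ_i^(2p)` is at most the trace `∑ λ_j^(2p)`, so the `p`-th root `r` of the trace dominates
every `λ_i²`, and Parseval transfers this to vectors. -/
theorem norm_apply_pow_le_trace {X : V →L[ℝ] V} (hX : (X : V →ₗ[ℝ] V).IsSymmetric) {p : ℕ}
    (hp : 0 < p) (v : V) :
    ‖X v‖ ^ (2 * p) ≤ traceCLM V (X ^ (2 * p)) * ‖v‖ ^ (2 * p) := by
  obtain ⟨b, l, hb⟩ := exists_eigenbasis hX
  have hc := traceCLM_even_pow_nonneg hX p
  set c := traceCLM V (X ^ (2 * p)) with hcdef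
  have hr : (c ^ ((p : ℝ)⁻¹)) ^ p = c := Real.rpow_inv_natCast_pow hc hp.ne'
  set r := c ^ ((p : ℝ)⁻¹) with hrdef
  have hr0 : 0 ≤ r := Real.rpow_nonneg hc _
  have hl : ∀ i, l i ^ 2 ≤ r := by
    intro i
    refine le_of_pow_le_pow_left₀ hp.ne' hr0 ?_
    rw [hr, ← pow_mul, hcdef, traceCLM_pow_eq_sum hb]
    exact Finset.single_le_sum (f := fun i => l i ^ (2 * p))
      (fun i _ => (even_two_mul p).pow_nonneg _) (Finset.mem_univ i)
  have h1 : ‖X v‖ ^ 2 ≤ r * ‖v‖ ^ 2 := by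
    rw [← b.sum_sq_norm_inner_right, ← b.sum_sq_norm_inner_right v, Finset.mul_sum]
    refine Finset.sum_le_sum fun i _ => ?_
    have h2 : inner ℝ (b i) (X v) = l i * inner ℝ (b i) v := by
      have h3 := isSymmetric_pow hX 1 (b i) v
      rw [hb 1 i] at h3
      simpa [inner_smul_left] using h3.symm
    rw [h2, norm_mul, mul_pow, Real.norm_eq_abs, sq_abs]
    gcongr
    exact hl i
  calc ‖X v‖ ^ (2 * p) = (‖X v‖ ^ 2) ^ p := pow_mul _ _ _
    _ ≤ (r * ‖v‖ ^ 2) ^ p := by gcongr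
    _ = c * ‖v‖ ^ (2 * p) := by rw [mul_pow, hr, ← pow_mul]

theorem abs_pow_mul_pow_le (x y : ℝ) {a b q : ℕ} (h : a + b = 2 * q) :
    x ^ a * y ^ b ≤ x ^ (2 * q) + y ^ (2 * q) := by
  have key : ∀ u v : ℝ, |u| ≤ |v| → ∀ a b : ℕ, a + b = 2 * q → u ^ a * v ^ b ≤ v ^ (2 * q) := by
    intro u v huv a b h
    calc u ^ a * v ^ b ≤ |u ^ a * v ^ b| := le_abs_self _
      _ = |u| ^ a * |v| ^ b := by rw [abs_mul, abs_pow, abs_pow]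
      _ ≤ |v| ^ a * |v| ^ b := by gcongr
      _ = v ^ (2 * q) := by rw [← pow_add, h, (even_two_mul q).pow_abs]
  have hx := (even_two_mul q).pow_nonneg x
  have hy := (even_two_mul q).pow_nonneg y
  rcases le_total |x| |y| with hxy | hxy
  · linarith [key x y hxy a b h]
  · have := key y x hxy b a (by omega)
    rw [mul_comm]
    linarith

/-- In an eigenbasis of `X` the trace is `∑ λ_j^a λ_i^b Y_ij²`. The mixed powers are split by
`abs_pow_mul_pow_le`, and by symmetry both resulting sums are controlled by the columns of `Y`, of
squared length at most `σ²`. No commutation of `X` and `Y` is needed. -/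
theorem traceCLM_pow_mul_pow_mul_le {X Y : V →L[ℝ] V} (hX : (X : V →ₗ[ℝ] V).IsSymmetric)
    (hY : (Y : V →ₗ[ℝ] V).IsSymmetric) {σ : ℝ} (hσ : ∀ v, ‖Y v‖ ≤ σ * ‖v‖) {a b q : ℕ}
    (h : a + b = 2 * q) :
    traceCLM V (X ^ a * Y * X ^ b * Y) ≤ (2 * σ) ^ 2 * traceCLM V (X ^ (2 * q)) := by
  obtain ⟨e, l, he⟩ := exists_eigenbasis hX
  have hY' : ∀ v w, inner ℝ (Y v) w = inner ℝ v (Y w) := hY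
  have hcol : ∀ j, ∑ i, inner ℝ (e i) (Y (e j)) ^ 2 ≤ σ ^ 2 := by
    intro j
    have h1 : ∑ i, inner ℝ (e i) (Y (e j)) ^ 2 = ‖Y (e j)‖ ^ 2 := by
      rw [← e.sum_sq_norm_inner_right]
      simp
    rw [h1]
    have h2 := hσ (e j)
    rw [e.norm_eq_one, mul_one] at h2
    gcongr
  have hterm : ∀ j, inner ℝ (e j) ((X ^ a * Y * X ^ b * Y) (e j)) =
      ∑ i, l j ^ a * l i ^ b * inner ℝ (e i) (Y (e j)) ^ 2 := by
    intro j
    simp only [mul_apply_eq_comp]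
    rw [← isSymmetric_pow hX, he, inner_smul_left, ← hY', ← e.sum_inner_mul_inner, Finset.mul_sum]
    refine Finset.sum_congr rfl fun i _ => ?_
    rw [← isSymmetric_pow hX, he, inner_smul_left, real_inner_comm]
    simp
    ring
  rw [traceCLM_eq_sum_inner e, traceCLM_pow_eq_sum he]
  simp_rw [hterm]
  calc ∑ j, ∑ i, l j ^ a * l i ^ b * inner ℝ (e i) (Y (e j)) ^ 2
      ≤ ∑ j, ∑ i, (l j ^ (2 * q) + l i ^ (2 * q)) * inner ℝ (e i) (Y (e j)) ^ 2 := by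
        gcongr with j _ i _
        exact abs_pow_mul_pow_le _ _ h
    _ = ∑ j, l j ^ (2 * q) * ∑ i, inner ℝ (e i) (Y (e j)) ^ 2 +
        ∑ i, l i ^ (2 * q) * ∑ j, inner ℝ (e j) (Y (e i)) ^ 2 := by
        simp_rw [add_mul, Finset.sum_add_distrib, Finset.mul_sum]
        congr 1
        rw [Finset.sum_comm]
        refine Finset.sum_congr rfl fun i _ => Finset.sum_congr rfl fun j _ => ?_
        rw [← hY', real_inner_comm]
    _ ≤ ∑ j, l j ^ (2 * q) * σ ^ 2 + ∑ i, l i ^ (2 * q) * σ ^ 2 := by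
        gcongr with j _ j _
        · exact (even_two_mul q).pow_nonneg _
        · exact hcol j
        · exact (even_two_mul q).pow_nonneg _
        · exact hcol j
    _ = 2 * σ ^ 2 * ∑ i, l i ^ (2 * q) := by
        rw [← Finset.sum_mul]; ring
    -- The factor 2 is given away so that the constant is a perfect square, with root `κ = 2σ`
    -- below.
    _ ≤ (2 * σ) ^ 2 * ∑ i, l i ^ (2 * q) := by
        gcongr ?_ * _
        · exact Finset.sum_nonneg fun i _ => (even_two_mul q).pow_nonneg _
        · nlinarith [sq_nonneg σ]

/-- The derivative of `s ↦ tr (X + s Y) ^ n`. -/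
theorem hasDerivAt_traceCLM_pow (X Y : V →L[ℝ] V) (n : ℕ) (s : ℝ) :
    HasDerivAt (fun s : ℝ => traceCLM V ((X + s • Y) ^ n))
      (n * traceCLM V ((X + s • Y) ^ (n - 1) * Y)) s := by
  have h0 : HasDerivAt (fun s : ℝ => X + s • Y) Y s := by
    simpa using ((hasDerivAt_id s).smul_const Y).const_add X
  have h1 := (traceCLM V).hasFDerivAt.comp_hasDerivAt s (h0.fun_pow' n)
  refine h1.congr_deriv ?_
  rw [map_sum]
  have : ∀ i ∈ Finset.range n, traceCLM V ((X + s • Y) ^ (n.pred - i) * Y * (X + s • Y) ^ i) =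
      traceCLM V ((X + s • Y) ^ (n - 1) * Y) := by
    intro i hi
    rw [traceCLM_mul_comm, ← mul_assoc, ← pow_add]
    congr 3
    have := Finset.mem_range.1 hi
    simp only [Nat.pred_eq_sub_one]
    omega
  rw [Finset.sum_congr rfl this]
  simp

theorem hasDerivAt_traceCLM_pow_mul (X Y : V →L[ℝ] V) (n : ℕ) (s : ℝ) :
    HasDerivAt (fun s : ℝ => traceCLM V ((X + s • Y) ^ n * Y))
      (∑ i ∈ Finset.range n,
        traceCLM V ((X + s • Y) ^ (n - 1 - i) * Y * (X + s • Y) ^ i * Y)) s := by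
  have h0 : HasDerivAt (fun s : ℝ => X + s • Y) Y s := by
    simpa using ((hasDerivAt_id s).smul_const Y).const_add X
  have h1 := (traceCLM V).hasFDerivAt.comp_hasDerivAt s ((h0.fun_pow' n).mul_const Y)
  refine h1.congr_deriv ?_
  rw [Finset.sum_mul, map_sum]
  rfl

/-- A differential inequality of the form `C'' ≤ κ² C`. -/
theorem le_cosh_add_sinh_of_deriv2_le {C C' C'' : ℝ → ℝ} {κ : ℝ} (hκ : 0 < κ)
    (h1 : ∀ s, HasDerivAt C (C' s) s) (h2 : ∀ s, HasDerivAt C' (C'' s) s)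
    (h3 : ∀ s, C'' s ≤ κ ^ 2 * C s) :
    C 1 ≤ Real.cosh κ * C 0 + Real.sinh κ / κ * C' 0 := by
  set k := C' 0 + κ * C 0 with hk
  have hexp : ∀ (c s : ℝ), HasDerivAt (fun s => Real.exp (c * s)) (Real.exp (c * s) * c) s := by
    intro c s
    simpa using ((hasDerivAt_id s).const_mul c).exp
  -- `C'' - κ² C` factors as `(d/ds - κ)(d/ds + κ) C`; each first-order factor is integrated in
  -- turn, which requires no sign of `C`.
  have hq : Antitone fun s => Real.exp (-κ * s) * (C' s + κ * C s) := by
    refine antitone_of_hasDerivAt_nonpos (f' := fun s => Real.exp (-κ * s) * (-κ) *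
      (C' s + κ * C s) + Real.exp (-κ * s) * (C'' s + κ * C' s)) (fun s => ?_) fun s => ?_
    · exact (hexp (-κ) s).mul ((h2 s).add ((h1 s).const_mul κ))
    · have : Real.exp (-κ * s) * (-κ) * (C' s + κ * C s) + Real.exp (-κ * s) * (C'' s + κ * C' s)
        = Real.exp (-κ * s) * (C'' s - κ ^ 2 * C s) := by ring
      show Real.exp (-κ * s) * (-κ) * (C' s + κ * C s) + Real.exp (-κ * s) * (C'' s + κ * C' s) ≤ 0
      rw [this]
      exact mul_nonpos_of_nonneg_of_nonpos (Real.exp_pos _).le (by linarith [h3 s])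
  -- The first integration gives `C' + κ C ≤ k exp(κ s)` for `s ≥ 0`; multiplied by `exp(κ s)`, this
  -- compares `(exp(κ s) C)'` with `k exp(2 κ s)`.
  have hr : AntitoneOn (fun s => Real.exp (κ * s) * C s - k * (Real.exp (2 * κ * s) / (2 * κ)))
      (Set.Ici 0) := by
    have hd : ∀ s, HasDerivAt
        (fun s => Real.exp (κ * s) * C s - k * (Real.exp (2 * κ * s) / (2 * κ)))
        (Real.exp (κ * s) * κ * C s + Real.exp (κ * s) * C' s -
          k * (Real.exp (2 * κ * s) * (2 * κ) / (2 * κ))) s := fun s =>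
      ((hexp κ s).mul (h1 s)).sub (((hexp (2 * κ) s).div_const _).const_mul k)
    refine antitoneOn_of_deriv_nonpos (convex_Ici 0)
      (fun s _ => (hd s).continuousAt.continuousWithinAt)
      (fun s _ => (hd s).differentiableAt.differentiableWithinAt) fun s hs => ?_
    rw [(hd s).deriv]
    rw [interior_Ici] at hs
    have h4 : Real.exp (-κ * s) * (C' s + κ * C s) ≤ k := by
      have := hq (le_of_lt hs)
      simpa [hk] using this
    have h5 : Real.exp (2 * κ * s) * (Real.exp (-κ * s) * (C' s + κ * C s)) ≤
        Real.exp (2 * κ * s) * k := by gcongr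
    rw [← mul_assoc, ← Real.exp_add, show 2 * κ * s + -κ * s = κ * s by ring] at h5
    rw [mul_div_assoc, div_self (by positivity)]
    linarith
  have h6 := hr (Set.mem_Ici.2 le_rfl) (Set.mem_Ici.2 zero_le_one) zero_le_one
  simp only [mul_one, mul_zero, Real.exp_zero, one_mul] at h6
  have h7 : Real.exp (-κ) * (Real.exp κ * C 1) ≤
      Real.exp (-κ) * (C 0 - k * (1 / (2 * κ)) + k * (Real.exp (2 * κ) / (2 * κ))) := by
    gcongr
    linarith
  have h8 : Real.exp (-κ) * Real.exp κ = 1 := by rw [← Real.exp_add]; simp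
  have h9 : Real.exp (-κ) * Real.exp (2 * κ) = Real.exp κ := by
    rw [← Real.exp_add]; congr 1; ring
  rw [← mul_assoc, h8, one_mul] at h7
  refine h7.trans (le_of_eq ?_)
  rw [Real.cosh_eq, Real.sinh_eq, hk]
  generalize Real.exp (2 * κ) = z at h9 ⊢
  field_simp
  linear_combination (C' 0 + κ * C 0) * h9

/-- The truncated trace hyperbolic cosine. -/
noncomputable def traceCosh (p : ℕ) (X : V →L[ℝ] V) : ℝ :=
  ∑ q ∈ Finset.range (p + 1), traceCLM V (X ^ (2 * q)) / (2 * q).factorial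

/-- The truncated hyperbolic sine. -/
noncomputable def opSinh (p : ℕ) (X : V →L[ℝ] V) : V →L[ℝ] V :=
  ∑ q ∈ Finset.range p, ((2 * q + 1).factorial : ℝ)⁻¹ • X ^ (2 * q + 1)

/-- The differential inequality is applied along the segment from `X` to `X + Y`. The point of the
form is that the last term is linear in `Y`, hence vanishes in expectation when `Y` is centred. -/
theorem traceCosh_add_le {X Y : V →L[ℝ] V} (hX : (X : V →ₗ[ℝ] V).IsSymmetric)
    (hY : (Y : V →ₗ[ℝ] V).IsSymmetric) {σ : ℝ} (hσ0 : 0 < σ) (hσ : ∀ v, ‖Y v‖ ≤ σ * ‖v‖) (p : ℕ) :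
    traceCosh p (X + Y) ≤ Real.cosh (2 * σ) * traceCosh p X +
      Real.sinh (2 * σ) / (2 * σ) * traceCLM V (opSinh p X * Y) := by
  have hkey := le_cosh_add_sinh_of_deriv2_le (κ := 2 * σ) (C := fun s => traceCosh p (X + s • Y))
    (C' := fun s => ∑ q ∈ Finset.range p, traceCLM V ((X + s • Y) ^ (2 * q + 1) * Y) /
      (2 * q + 1).factorial)
    (C'' := fun s => ∑ q ∈ Finset.range p, (∑ i ∈ Finset.range (2 * q + 1),
        traceCLM V ((X + s • Y) ^ (2 * q - i) * Y * (X + s • Y) ^ i * Y)) /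
      (2 * q + 1).factorial) (by positivity) ?_ ?_ ?_
  · simp only [one_smul, zero_smul, add_zero] at hkey
    refine hkey.trans (le_of_eq ?_)
    congr 2
    rw [opSinh, Finset.sum_mul, map_sum]
    refine Finset.sum_congr rfl fun q _ => ?_
    rw [smul_mul_assoc, map_smul, smul_eq_mul, div_eq_inv_mul]
  · intro s
    have h1 : HasDerivAt (fun s : ℝ => traceCosh p (X + s • Y)) (∑ q ∈ Finset.range (p + 1),
        ((2 * q : ℕ) * traceCLM V ((X + s • Y) ^ (2 * q - 1) * Y)) / (2 * q).factorial) s := by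
      unfold traceCosh
      exact HasDerivAt.fun_sum fun q _ => (hasDerivAt_traceCLM_pow X Y (2 * q) s).div_const _
    refine h1.congr_deriv ?_
    -- The term `q = 0` is constant; the shift `q ↦ q + 1` leaves the odd powers `2q + 1` with `q <
    -- p`.
    rw [Finset.sum_range_succ']
    simp only [mul_zero, Nat.cast_zero, zero_mul, zero_div, add_zero]
    refine Finset.sum_congr rfl fun q _ => ?_
    rw [show 2 * (q + 1) = (2 * q + 1) + 1 by ring, Nat.factorial_succ, Nat.add_sub_cancel]
    have : ((2 * q + 1).factorial : ℝ) ≠ 0 := by positivity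
    push_cast
    field_simp
  · intro s
    exact HasDerivAt.fun_sum fun q _ => (hasDerivAt_traceCLM_pow_mul X Y (2 * q + 1) s).div_const _
  · intro s
    have hZ := isSymmetric_add_smul hX hY s
    have h1 : ∀ q ∈ Finset.range p, (∑ i ∈ Finset.range (2 * q + 1),
        traceCLM V ((X + s • Y) ^ (2 * q - i) * Y * (X + s • Y) ^ i * Y)) /
        (2 * q + 1).factorial ≤
        (2 * σ) ^ 2 * (traceCLM V ((X + s • Y) ^ (2 * q)) / (2 * q).factorial) := by
      intro q _
      have h2 : ∑ i ∈ Finset.range (2 * q + 1),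
          traceCLM V ((X + s • Y) ^ (2 * q - i) * Y * (X + s • Y) ^ i * Y) ≤
          ∑ i ∈ Finset.range (2 * q + 1), (2 * σ) ^ 2 * traceCLM V ((X + s • Y) ^ (2 * q)) := by
        refine Finset.sum_le_sum fun i hi => ?_
        have := Finset.mem_range.1 hi
        exact traceCLM_pow_mul_pow_mul_le hZ hY hσ (by omega)
      rw [Finset.sum_const, Finset.card_range, nsmul_eq_mul] at h2
      rw [div_le_iff₀ (by positivity), Nat.factorial_succ]
      refine h2.trans (le_of_eq ?_)
      have : ((2 * q).factorial : ℝ) ≠ 0 := by positivity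
      push_cast
      field_simp
    refine (Finset.sum_le_sum h1).trans ?_
    rw [← Finset.mul_sum]
    unfold traceCosh
    -- Differentiating twice loses the top degree, so only `q < p` occurs on the left; the missing
    -- summand is nonnegative because its power is even.
    rw [Finset.sum_range_succ]
    gcongr
    have := traceCLM_even_pow_nonneg hZ p
    have h3 : 0 ≤ traceCLM V ((X + s • Y) ^ (2 * p)) / (2 * p).factorial := by positivity
    linarith

end TraceInequalities

/-! ### Concentration of sums of independent operators -/

section OperatorConcentration

variable {V : Type*} [NormedAddCommGroup V] [InnerProductSpace ℝ V]
variable {Ξ : Type*} [MeasurableSpace Ξ]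

theorem isSymmetric_sum {ι : Type*} (s : Finset ι) {X : ι → V →L[ℝ] V}
    (hX : ∀ i, (X i : V →ₗ[ℝ] V).IsSymmetric) :
    ((∑ i ∈ s, X i : V →L[ℝ] V) : V →ₗ[ℝ] V).IsSymmetric := by
  intro v w
  have h : ∀ i, inner ℝ (X i v) w = inner ℝ v (X i w) := fun i => hX i v w
  simp [sum_inner, inner_sum, h]

variable [FiniteDimensional ℝ V]

theorem continuous_traceCosh (p : ℕ) : Continuous (traceCosh (V := V) p) := by
  unfold traceCosh
  fun_prop

theorem traceCosh_zero (p : ℕ) : traceCosh p (0 : V →L[ℝ] V) = Module.finrank ℝ V := by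
  unfold traceCosh
  rw [Finset.sum_eq_single 0]
  · simp [traceCLM_apply]
  · intro q _ hq
    simp [hq]
  · simp

theorem traceCosh_nonneg {X : V →L[ℝ] V} (hX : (X : V →ₗ[ℝ] V).IsSymmetric) (p : ℕ) :
    0 ≤ traceCosh p X :=
  Finset.sum_nonneg fun q _ => div_nonneg (traceCLM_even_pow_nonneg hX q) (by positivity)

theorem traceCLM_pow_le_traceCosh {X : V →L[ℝ] V} (hX : (X : V →ₗ[ℝ] V).IsSymmetric) (p : ℕ) :
    traceCLM V (X ^ (2 * p)) ≤ (2 * p).factorial * traceCosh p X := by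
  have h : traceCLM V (X ^ (2 * p)) / (2 * p).factorial ≤ traceCosh p X :=
    Finset.single_le_sum
      (f := fun q => traceCLM V (X ^ (2 * q)) / (2 * q).factorial)
      (fun q _ => div_nonneg (traceCLM_even_pow_nonneg hX q) (by positivity))
      (Finset.mem_range.2 (Nat.lt_succ_self p))
  rw [div_le_iff₀ (by positivity)] at h
  linarith

theorem integrable_comp_of_bounded {α W : Type*} [MeasurableSpace α] {μ : Measure α}
    [IsFiniteMeasure μ] [NormedAddCommGroup W] [ProperSpace W] {φ : W → ℝ} (hφ : Continuous φ)
    {f : α → W} (hf : AEStronglyMeasurable f μ) {R : ℝ} (hR : ∀ᵐ a ∂μ, ‖f a‖ ≤ R) :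
    Integrable (fun a => φ (f a)) μ := by
  obtain ⟨c, hc⟩ := (isCompact_closedBall (0 : W) R).exists_bound_of_continuousOn hφ.continuousOn
  refine Integrable.of_bound (hφ.comp_aestronglyMeasurable hf) c ?_
  filter_upwards [hR] with a ha
  exact hc _ (by simpa using ha)

theorem ae_pi_norm_sum_le {W : Type*} [NormedAddCommGroup W] {D : Measure Ξ}
    [IsProbabilityMeasure D] {Y : Ξ → W} {σ : ℝ} (hb : ∀ᵐ ξ ∂D, ‖Y ξ‖ ≤ σ) (N : ℕ) :
    ∀ᵐ a ∂(Measure.pi fun _ : Fin N => D), ‖∑ r, Y (a r)‖ ≤ N * σ := by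
  have h : ∀ᵐ a ∂(Measure.pi fun _ : Fin N => D), ∀ r, ‖Y (a r)‖ ≤ σ :=
    ae_all_iff.2 fun r => (Measure.tendsto_eval_ae_ae (μ := fun _ : Fin N => D) (i := r)).eventually hb
  filter_upwards [h] with a ha
  calc ‖∑ r, Y (a r)‖ ≤ ∑ r, ‖Y (a r)‖ := norm_sum_le _ _
    _ ≤ ∑ _r : Fin N, σ := Finset.sum_le_sum fun r _ => ha r
    _ = N * σ := by simp

/-- Each new summand costs one factor `cosh (2σ)`: with the others frozen, the linear term
integrates to zero. The starting value is the trace of the identity. -/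
theorem integral_traceCosh_sum_le {D : Measure Ξ} [IsProbabilityMeasure D] {Y : Ξ → V →L[ℝ] V}
    (hY : StronglyMeasurable Y) (hsymm : ∀ ξ, (Y ξ : V →ₗ[ℝ] V).IsSymmetric) {σ : ℝ} (hσ : 0 < σ)
    (hb : ∀ᵐ ξ ∂D, ‖Y ξ‖ ≤ σ) (h0 : ∫ ξ, Y ξ ∂D = 0) (p N : ℕ) :
    ∫ a, traceCosh p (∑ r, Y (a r)) ∂(Measure.pi fun _ : Fin N => D) ≤
      Real.cosh (2 * σ) ^ N * Module.finrank ℝ V := by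
  have hsm : ∀ N : ℕ, StronglyMeasurable fun a : Fin N → Ξ => ∑ r, Y (a r) := fun N =>
    Finset.stronglyMeasurable_fun_sum _ fun r _ => hY.comp_measurable (measurable_pi_apply r)
  have hint : ∀ N : ℕ, Integrable (fun a : Fin N → Ξ => traceCosh p (∑ r, Y (a r)))
      (Measure.pi fun _ : Fin N => D) := fun N =>
    integrable_comp_of_bounded (continuous_traceCosh p) (hsm N).aestronglyMeasurable
      (ae_pi_norm_sum_le hb N)
  induction N with
  | zero => simp [traceCosh_zero]
  | succ N ih =>
    have hmp := measurePreserving_piFinSuccAbove (fun _ : Fin (N + 1) => D) 0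
    have h1 : ∫ a, traceCosh p (∑ r, Y (a r)) ∂(Measure.pi fun _ : Fin (N + 1) => D) =
        ∫ z : Ξ × (Fin N → Ξ), traceCosh p (Y z.1 + ∑ r, Y (z.2 r))
          ∂(D.prod (Measure.pi fun _ : Fin N => D)) := by
      rw [← hmp.integral_comp' (fun z : Ξ × (Fin N → Ξ) => traceCosh p (Y z.1 + ∑ r, Y (z.2 r)))]
      refine integral_congr_ae (Filter.Eventually.of_forall fun a => ?_)
      simp only [Fin.sum_univ_succ]
      rfl
    have hint2 : Integrable (fun z : Ξ × (Fin N → Ξ) => traceCosh p (Y z.1 + ∑ r, Y (z.2 r)))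
        (D.prod (Measure.pi fun _ : Fin N => D)) := by
      rw [← hmp.integrable_comp_emb (MeasurableEquiv.measurableEmbedding _)]
      refine (hint (N + 1)).congr (Filter.Eventually.of_forall fun a => ?_)
      simp only [Fin.sum_univ_succ]
      rfl
    rw [h1, integral_prod_symm _ hint2]
    have hYint : Integrable Y D := Integrable.of_bound hY.aestronglyMeasurable σ hb
    calc ∫ b : Fin N → Ξ, ∫ ξ, traceCosh p (Y ξ + ∑ r, Y (b r)) ∂D ∂(Measure.pi fun _ => D)
        ≤ ∫ b : Fin N → Ξ, Real.cosh (2 * σ) * traceCosh p (∑ r, Y (b r))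
            ∂(Measure.pi fun _ => D) := by
          refine integral_mono hint2.integral_prod_right ((hint N).const_mul _) fun b => ?_
          set S := ∑ r, Y (b r) with hS
          -- The linear term as a continuous functional of the new summand, so that it commutes with
          -- the integral.
          set L : (V →L[ℝ] V) →L[ℝ] ℝ := (Real.sinh (2 * σ) / (2 * σ)) •
            (traceCLM V).comp (ContinuousLinearMap.mul ℝ (V →L[ℝ] V) (opSinh p S)) with hL
          have hLint : Integrable (fun ξ => L (Y ξ)) D := L.integrable_comp hYint
          have h2 : ∫ ξ, L (Y ξ) ∂D = 0 := by
            rw [L.integral_comp_comm hYint, h0, map_zero]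
          show ∫ ξ, traceCosh p (Y ξ + S) ∂D ≤ Real.cosh (2 * σ) * traceCosh p S
          calc ∫ ξ, traceCosh p (Y ξ + S) ∂D
              ≤ ∫ ξ, (Real.cosh (2 * σ) * traceCosh p S + L (Y ξ)) ∂D := by
                refine integral_mono_ae ?_ ((integrable_const _).add hLint) ?_
                · refine integrable_comp_of_bounded (φ := fun X => traceCosh p (X + S))
                    ((continuous_traceCosh p).comp (continuous_add_const S))
                    hY.aestronglyMeasurable hb
                · filter_upwards [hb] with ξ hξ
                  rw [add_comm]
                  exact traceCosh_add_le (isSymmetric_sum _ fun r => hsymm _) (hsymm ξ) hσ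
                    (fun v => (Y ξ).le_of_opNorm_le hξ v) p
            _ = Real.cosh (2 * σ) * traceCosh p S := by
                rw [integral_add (integrable_const _) hLint, h2]
                simp
      _ = Real.cosh (2 * σ) * ∫ b : Fin N → Ξ, traceCosh p (∑ r, Y (b r))
            ∂(Measure.pi fun _ => D) := integral_const_mul _ _
      _ ≤ Real.cosh (2 * σ) * (Real.cosh (2 * σ) ^ N * Module.finrank ℝ V) := by
          gcongr
      _ = Real.cosh (2 * σ) ^ (N + 1) * Module.finrank ℝ V := by ring

theorem pow_le_trace_of_lt_norm {X : V →L[ℝ] V} (hX : (X : V →ₗ[ℝ] V).IsSymmetric) {p : ℕ}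
    (hp : 0 < p) {t : ℝ} (ht : 0 ≤ t) (h : t < ‖X‖) : t ^ (2 * p) ≤ traceCLM V (X ^ (2 * p)) := by
  by_contra! hlt
  refine h.not_ge (X.opNorm_le_bound ht fun v => ?_)
  refine le_of_pow_le_pow_left₀ (n := 2 * p) (by omega) (by positivity) ?_
  rw [mul_pow]
  refine (norm_apply_pow_le_trace hX hp v).trans ?_
  gcongr

/-- Tail bound for the norm of a sum of independent centred bounded symmetric operators. -/
theorem measure_norm_sum_symm_gt_le {D : Measure Ξ} [IsProbabilityMeasure D] {Y : Ξ → V →L[ℝ] V}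
    (hY : StronglyMeasurable Y) (hsymm : ∀ ξ, (Y ξ : V →ₗ[ℝ] V).IsSymmetric) {σ : ℝ} (hσ : 0 < σ)
    (hb : ∀ᵐ ξ ∂D, ‖Y ξ‖ ≤ σ) (h0 : ∫ ξ, Y ξ ∂D = 0) {p N : ℕ} (hp : 0 < p) (hN : 0 < N) {t : ℝ}
    (ht : 0 < t) (h : 4 * Real.exp 3 * p * σ ^ 2 ≤ N * t ^ 2) :
    (Measure.pi fun _ : Fin N => D).real {a | N * t < ‖∑ r, Y (a r)‖} ≤
      Module.finrank ℝ V * Real.exp (-p) := by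
  have hp' : (0 : ℝ) < p := by exact_mod_cast hp
  have hN' : (0 : ℝ) < N := by exact_mod_cast hN
  -- This scaling makes the moment bound `cosh (2θσ)^N ≤ exp(2 N θ² σ²)` equal to `exp(2p)`.
  set θ : ℝ := Real.sqrt (p / (N * σ ^ 2)) with hθ
  have hθ0 : 0 < θ := Real.sqrt_pos.2 (by positivity)
  have hθ2 : θ ^ 2 = p / (N * σ ^ 2) := Real.sq_sqrt (by positivity)
  set μ := Measure.pi fun _ : Fin N => D with hμ
  have hsymm' : ∀ ξ, ((θ • Y ξ : V →L[ℝ] V) : V →ₗ[ℝ] V).IsSymmetric := fun ξ => by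
    have h1 := isSymmetric_add_smul (X := (0 : V →L[ℝ] V)) (by intro v w; simp) (hsymm ξ) θ
    rwa [zero_add] at h1
  have hb' : ∀ᵐ ξ ∂D, ‖θ • Y ξ‖ ≤ θ * σ := by
    filter_upwards [hb] with ξ hξ
    rw [norm_smul, Real.norm_of_nonneg hθ0.le]
    gcongr
  have hE := integral_traceCosh_sum_le (hY.const_smul θ) hsymm' (mul_pos hθ0 hσ) hb'
    (by
      have : ∫ ξ, (θ • Y) ξ ∂D = θ • ∫ ξ, Y ξ ∂D := integral_smul θ Y
      rw [this, h0, smul_zero]) p N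
  set R : ℝ := (θ * (N * t)) ^ (2 * p) / (2 * p).factorial with hR
  have hR0 : 0 < R := by positivity
  have hsum : ∀ a : Fin N → Ξ, ∑ r, (θ • Y) (a r) = θ • ∑ r, Y (a r) := fun a => by
    rw [Finset.smul_sum]; rfl
  have hsub : {a : Fin N → Ξ | N * t < ‖∑ r, Y (a r)‖} ⊆
      {a | R ≤ traceCosh p (∑ r, (θ • Y) (a r))} := by
    intro a ha
    have hs := isSymmetric_sum Finset.univ (fun r => hsymm' (a r))
    have h1 : θ * (N * t) < ‖∑ r, (θ • Y) (a r)‖ := by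
      rw [hsum, norm_smul, Real.norm_of_nonneg hθ0.le]
      exact mul_lt_mul_of_pos_left ha hθ0
    have h2 := pow_le_trace_of_lt_norm hs hp (by positivity) h1
    have h3 := traceCLM_pow_le_traceCosh hs p
    show R ≤ traceCosh p _
    rw [hR, div_le_iff₀ (by positivity)]
    calc _ ≤ _ := h2
      _ ≤ _ := h3
      _ = _ := mul_comm _ _
  have hsm : StronglyMeasurable fun a : Fin N → Ξ => ∑ r, (θ • Y) (a r) :=
    Finset.stronglyMeasurable_fun_sum _ fun r _ =>
      (hY.const_smul θ).comp_measurable (measurable_pi_apply r)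
  have hM := mul_meas_ge_le_integral_of_nonneg (μ := μ)
    (f := fun a => traceCosh p (∑ r, (θ • Y) (a r)))
    (Filter.Eventually.of_forall fun a => traceCosh_nonneg (isSymmetric_sum _ fun r => hsymm' _) p)
    (integrable_comp_of_bounded (continuous_traceCosh p) hsm.aestronglyMeasurable
      (ae_pi_norm_sum_le hb' N)) R
  have hle : R * μ.real {a | N * t < ‖∑ r, Y (a r)‖} ≤
      Real.exp (2 * p) * Module.finrank ℝ V := by
    calc R * μ.real {a | N * t < ‖∑ r, Y (a r)‖}
        ≤ R * μ.real {a | R ≤ traceCosh p (∑ r, (θ • Y) (a r))} := by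
          gcongr
          exact measure_ne_top _ _
      _ ≤ Real.cosh (2 * (θ * σ)) ^ N * Module.finrank ℝ V := hM.trans hE
      _ ≤ Real.exp ((2 * (θ * σ)) ^ 2 / 2) ^ N * Module.finrank ℝ V := by
          gcongr
          exact Real.cosh_le_exp_half_sq _
      _ = Real.exp (2 * p) * Module.finrank ℝ V := by
          rw [← Real.exp_nat_mul]
          congr 2
          rw [mul_pow, mul_pow, hθ2]
          field_simp
  -- With `(2p)! ≤ (2p)^(2p)`, the size condition makes the Markov threshold at least `exp(3p)`;
  -- against `exp(2p)` this leaves `exp(-p)`.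
  have hRlow : Real.exp (3 * p) ≤ R := by
    rw [hR, le_div_iff₀ (by positivity)]
    have hfac : ((2 * p).factorial : ℝ) ≤ (2 * p : ℝ) ^ (2 * p) := by
      exact_mod_cast Nat.factorial_le_pow (2 * p)
    calc Real.exp (3 * p) * (2 * p).factorial ≤ Real.exp (3 * p) * (2 * p : ℝ) ^ (2 * p) := by
          gcongr
      _ = (Real.exp 3 * (4 * p ^ 2)) ^ p := by
          rw [mul_pow (Real.exp 3), ← Real.exp_nat_mul, pow_mul]
          congr 2 <;> ring
      _ ≤ ((θ * (N * t)) ^ 2) ^ p := by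
          gcongr
          rw [mul_pow, hθ2]
          rw [div_mul_eq_mul_div, le_div_iff₀ (by positivity)]
          have : (p * N : ℝ) * (4 * Real.exp 3 * p * σ ^ 2) ≤ (p * N) * (N * t ^ 2) := by gcongr
          linarith
      _ = (θ * (N * t)) ^ (2 * p) := by rw [← pow_mul]
  have hfin : Real.exp (3 * p) * μ.real {a | N * t < ‖∑ r, Y (a r)‖} ≤
      Real.exp (2 * p) * Module.finrank ℝ V := le_trans (by gcongr) hle
  have h3 : μ.real {a | N * t < ‖∑ r, Y (a r)‖} = Real.exp (-(3 * p)) *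
      (Real.exp (3 * p) * μ.real {a | N * t < ‖∑ r, Y (a r)‖}) := by
    rw [← mul_assoc, ← Real.exp_add]; simp
  rw [h3]
  calc _ ≤ Real.exp (-(3 * p)) * (Real.exp (2 * p) * Module.finrank ℝ V) := by gcongr
    _ = Module.finrank ℝ V * Real.exp (-p) := by
      rw [← mul_assoc, ← Real.exp_add, mul_comm]
      congr 2
      ring

end OperatorConcentration

/-! ### Self-adjoint dilation: from symmetric to rectangular operators -/

section Dilation

variable {E F : Type*} [NormedAddCommGroup E] [InnerProductSpace ℝ E] [FiniteDimensional ℝ E]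
  [CompleteSpace E] [NormedAddCommGroup F] [InnerProductSpace ℝ F] [FiniteDimensional ℝ F]
  [CompleteSpace F]

/-- The self-adjoint dilation `(v, w) ↦ (Z† w, Z v)`, linear in `Z`. -/
noncomputable def dilation (E F : Type*) [NormedAddCommGroup E] [InnerProductSpace ℝ E]
    [FiniteDimensional ℝ E] [CompleteSpace E] [NormedAddCommGroup F] [InnerProductSpace ℝ F]
    [FiniteDimensional ℝ F] [CompleteSpace F] :
    (E →L[ℝ] F) →L[ℝ] (WithLp 2 (E × F) →L[ℝ] WithLp 2 (E × F)) :=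
  LinearMap.toContinuousLinearMap
    { toFun := fun Z => ((WithLp.prodContinuousLinearEquiv 2 ℝ E F).symm : E × F →L[ℝ] _).comp
        (((ContinuousLinearMap.adjoint Z).comp (ContinuousLinearMap.snd ℝ E F)).prod
          (Z.comp (ContinuousLinearMap.fst ℝ E F)) |>.comp
          (WithLp.prodContinuousLinearEquiv 2 ℝ E F : WithLp 2 (E × F) →L[ℝ] E × F))
      map_add' := fun Z Z' => by ext x : 1; simp [← WithLp.toLp_add]
      map_smul' := fun c Z => by ext x : 1; simp [← WithLp.toLp_smul] }

theorem dilation_apply (Z : E →L[ℝ] F) (x : WithLp 2 (E × F)) :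
    dilation E F Z x = WithLp.toLp 2 (ContinuousLinearMap.adjoint Z x.snd, Z x.fst) := rfl

theorem dilation_isSymmetric (Z : E →L[ℝ] F) :
    (dilation E F Z : WithLp 2 (E × F) →ₗ[ℝ] WithLp 2 (E × F)).IsSymmetric := by
  intro x y
  show inner ℝ (dilation E F Z x) y = inner ℝ x (dilation E F Z y)
  rw [dilation_apply, dilation_apply, WithLp.prod_inner_apply, WithLp.prod_inner_apply]
  simp only [WithLp.ofLp_fst, WithLp.ofLp_snd]
  rw [ContinuousLinearMap.adjoint_inner_left, ContinuousLinearMap.adjoint_inner_right, add_comm]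

theorem norm_dilation_le (Z : E →L[ℝ] F) : ‖dilation E F Z‖ ≤ ‖Z‖ := by
  refine ContinuousLinearMap.opNorm_le_bound _ (norm_nonneg _) fun x => ?_
  refine le_of_pow_le_pow_left₀ two_ne_zero (by positivity) ?_
  rw [dilation_apply, mul_pow, WithLp.prod_norm_sq_eq_of_L2, WithLp.prod_norm_sq_eq_of_L2]
  have h1 : ‖ContinuousLinearMap.adjoint Z x.snd‖ ≤ ‖Z‖ * ‖x.snd‖ := by
    simpa using (ContinuousLinearMap.adjoint Z).le_opNorm x.snd
  have h2 := Z.le_opNorm x.fst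
  have h3 : ‖ContinuousLinearMap.adjoint Z x.snd‖ ^ 2 ≤ (‖Z‖ * ‖x.snd‖) ^ 2 := by gcongr
  have h4 : ‖Z x.fst‖ ^ 2 ≤ (‖Z‖ * ‖x.fst‖) ^ 2 := by gcongr
  show ‖ContinuousLinearMap.adjoint Z x.snd‖ ^ 2 + ‖Z x.fst‖ ^ 2 ≤ _
  rw [mul_pow] at h3 h4
  rw [mul_add]
  linarith

theorem norm_le_norm_dilation (Z : E →L[ℝ] F) : ‖Z‖ ≤ ‖dilation E F Z‖ := by
  refine ContinuousLinearMap.opNorm_le_bound _ (norm_nonneg (dilation E F Z)) fun v => ?_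
  have h := (dilation E F Z).le_opNorm (WithLp.toLp 2 (v, 0))
  have h1 : ‖(WithLp.toLp 2 (v, (0 : F)))‖ = ‖v‖ := by simp
  have h2 : dilation E F Z (WithLp.toLp 2 (v, (0 : F))) = WithLp.toLp 2 ((0 : E), Z v) := by
    rw [dilation_apply]; simp
  rw [h1, h2] at h
  simpa using h

/-- Tail bound for the norm of an average of independent centred bounded operators. -/
theorem measure_norm_mean_gt_le {Ξ : Type*} [MeasurableSpace Ξ] {D : Measure Ξ}
    [IsProbabilityMeasure D] {Z : Ξ → E →L[ℝ] F} (hZ : StronglyMeasurable Z) {σ : ℝ} (hσ : 0 < σ)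
    (hb : ∀ᵐ ξ ∂D, ‖Z ξ‖ ≤ σ) (h0 : ∫ ξ, Z ξ ∂D = 0) {p N : ℕ} (hp : 0 < p) (hN : 0 < N) {t : ℝ}
    (ht : 0 < t) (h : 4 * Real.exp 3 * p * σ ^ 2 ≤ N * t ^ 2) :
    (Measure.pi fun _ : Fin N => D).real {a | t < ‖(N : ℝ)⁻¹ • ∑ r, Z (a r)‖} ≤
      (Module.finrank ℝ E + Module.finrank ℝ F) * Real.exp (-p) := by
  have hN' : (0 : ℝ) < N := by exact_mod_cast hN
  have hZint : Integrable Z D := Integrable.of_bound hZ.aestronglyMeasurable σ hb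
  -- Dilation is linear and preserves the norm, so boundedness and centring pass to it; its space
  -- has dimension `dim E + dim F`, the prefactor of the tail.
  have hmain := measure_norm_sum_symm_gt_le (V := WithLp 2 (E × F)) (D := D)
    (Y := fun ξ => dilation E F (Z ξ)) ((dilation E F).continuous.comp_stronglyMeasurable hZ)
    (fun ξ => dilation_isSymmetric (Z ξ)) hσ
    (by filter_upwards [hb] with ξ hξ using (norm_dilation_le _).trans hξ)
    (by rw [ContinuousLinearMap.integral_comp_comm _ hZint, h0, map_zero]) hp hN ht h
  rw [(WithLp.linearEquiv 2 ℝ (E × F)).finrank_eq, Module.finrank_prod] at hmain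
  push_cast at hmain
  refine le_trans (measureReal_mono (fun a ha => ?_) (measure_ne_top _ _)) hmain
  have ha' : t < ‖(N : ℝ)⁻¹ • ∑ r, Z (a r)‖ := ha
  rw [norm_smul, Real.norm_of_nonneg (by positivity), inv_mul_eq_div, lt_div_iff₀ hN'] at ha'
  show N * t < ‖∑ r, dilation E F (Z (a r))‖
  rw [← map_sum]
  linarith [norm_le_norm_dilation (∑ r, Z (a r))]

end Dilation

/-! ### Descent of one inexact proximal step -/

namespace Problem

variable {n m : ℕ} {Ξ : Type*} [MeasurableSpace Ξ] {P : Problem n m Ξ} {lf lg Lg : ℝ≥0}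

theorem Standing.coe_toReal_h (hS : P.Standing lf lg Lg) {y : Vec n} (hy : P.h y ≠ ⊤) :
    P.h y = ((P.h y).toReal : EReal) := (EReal.coe_toReal hy (hS.ne_bot_h y)).symm

theorem Standing.model_eq_coe (hS : P.Standing lf lg Lg) (M : ℝ) (u : Vec m)
    (J : Vec n →L[ℝ] Vec m) (x : Vec n) {y : Vec n} (hy : P.h y ≠ ⊤) :
    P.model M u J x y =
      ((P.f (u + J (y - x)) + (P.h y).toReal + M / 2 * ‖y - x‖ ^ 2 : ℝ) : EReal) := by
  unfold model
  rw [hS.coe_toReal_h hy]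
  simp

theorem model_eq_top (M : ℝ) (u : Vec m) (J : Vec n →L[ℝ] Vec m) (x : Vec n) {y : Vec n}
    (hy : P.h y = ⊤) : P.model M u J x y = ⊤ := by
  unfold model
  rw [hy, EReal.coe_add_top, EReal.top_add_coe]

theorem Standing.Φ_eq_coe (hS : P.Standing lf lg Lg) {y : Vec n} (hy : P.h y ≠ ⊤) :
    P.Φ y = ((P.f (P.g y) + (P.h y).toReal : ℝ) : EReal) := by
  unfold Φ
  rw [hS.coe_toReal_h hy]
  simp

/-- The mean value inequality on the ball of radius `‖y - x‖` yields the constant `Lg` instead of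
the sharp `Lg / 2`; the margin in `M > 5 l_f L_g` affords it. -/
theorem Standing.norm_g_sub_le (hS : P.Standing lf lg Lg) (x y : Vec n) :
    ‖P.g y - P.g x - P.jac x (y - x)‖ ≤ Lg * ‖y - x‖ ^ 2 := by
  have h := Convex.norm_image_sub_le_of_norm_fderiv_le' (𝕜 := ℝ) (f := P.g) (φ := P.jac x)
    (s := Metric.closedBall x ‖y - x‖) (C := Lg * ‖y - x‖) (x := x) (y := y)
    (fun z _ => hS.differentiable_g z) (fun z hz => ?_) (convex_closedBall _ _)
    (Metric.mem_closedBall_self (norm_nonneg _)) (by simp [dist_eq_norm])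
  · rw [pow_two, ← mul_assoc]; exact h
  · have h1 := hS.lipschitz_jac.dist_le_mul z x
    rw [dist_eq_norm] at h1
    refine h1.trans ?_
    gcongr
    exact hz

theorem Standing.f_le (hS : P.Standing lf lg Lg) (a b : Vec m) :
    P.f a ≤ P.f b + lf * ‖a - b‖ := by
  have h := hS.lipschitz_f.dist_le_mul a b
  rw [Real.dist_eq, dist_eq_norm] at h
  linarith [le_abs_self (P.f a - P.f b)]

theorem Standing.f_g_le (hS : P.Standing lf lg Lg) (x y : Vec n) :
    P.f (P.g y) ≤ P.f (P.g x + P.jac x (y - x)) + lf * Lg * ‖y - x‖ ^ 2 := by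
  have h1 := hS.f_le (P.g y) (P.g x + P.jac x (y - x))
  have h2 := hS.norm_g_sub_le x y
  rw [← sub_sub] at h1
  have h3 : (lf : ℝ) * ‖P.g y - P.g x - P.jac x (y - x)‖ ≤ lf * (Lg * ‖y - x‖ ^ 2) := by gcongr
  linarith

theorem Standing.lowerSemicontinuous_model (hS : P.Standing lf lg Lg) (M : ℝ) (u : Vec m)
    (J : Vec n →L[ℝ] Vec m) (x : Vec n) : LowerSemicontinuous (P.model M u J x) := by
  have hf : Continuous P.f := hS.lipschitz_f.continuous
  have h1 : LowerSemicontinuous fun y => ((P.f (u + J (y - x)) : ℝ) : EReal) :=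
    (continuous_coe_real_ereal.comp (by fun_prop)).lowerSemicontinuous
  have h2 : LowerSemicontinuous fun y => ((M / 2 * ‖y - x‖ ^ 2 : ℝ) : EReal) :=
    (continuous_coe_real_ereal.comp (by fun_prop)).lowerSemicontinuous
  refine (h1.add' hS.closed_h fun y => ?_).add' h2 fun y => ?_
  · exact EReal.continuousAt_add (Or.inl (EReal.coe_ne_top _)) (Or.inl (EReal.coe_ne_bot _))
  · exact EReal.continuousAt_add (Or.inr (EReal.coe_ne_bot _)) (Or.inr (EReal.coe_ne_top _))

/-- The exact proximal model has a minimizer when the objective is bounded below. -/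
theorem Standing.proxStep_le (hS : P.Standing lf lg Lg) {M c : ℝ} (hM : 2 * (lf : ℝ) * Lg < M)
    (hc : ∀ y, P.h y ≠ ⊤ → c ≤ P.f (P.g y) + (P.h y).toReal) {x : Vec n} (hx : P.h x ≠ ⊤)
    (z : Vec n) : P.model M (P.g x) (P.jac x) x (P.proxStep M x) ≤
      P.model M (P.g x) (P.jac x) x z := by
  suffices h : ∃ y, ∀ z, P.model M (P.g x) (P.jac x) x y ≤ P.model M (P.g x) (P.jac x) x z from
    Classical.epsilon_spec h z
  set s := P.model M (P.g x) (P.jac x) x with hs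
  -- The model at `z` is at least `c + a ‖z - x‖²`, while at `x` it equals `c + b`. Outside radius
  -- `√(b/a)` it therefore exceeds its value at `x`, and lower semicontinuity on the compact ball
  -- suffices.
  set a : ℝ := M / 2 - lf * Lg with ha
  have ha0 : 0 < a := by rw [ha]; linarith
  set b : ℝ := P.f (P.g x) + (P.h x).toReal - c with hb
  have hb0 : 0 ≤ b := by rw [hb]; linarith [hc x hx]
  set R : ℝ := Real.sqrt (b / a) with hR
  have hR0 : 0 ≤ R := Real.sqrt_nonneg _
  obtain ⟨y, -, hy⟩ := LowerSemicontinuousOn.exists_isMinOn (s := Metric.closedBall x R)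
    ⟨x, Metric.mem_closedBall_self hR0⟩ (isCompact_closedBall x R)
    ((hS.lowerSemicontinuous_model M (P.g x) (P.jac x) x).lowerSemicontinuousOn _)
  refine ⟨y, fun z => ?_⟩
  by_cases hz : z ∈ Metric.closedBall x R
  · exact hy hz
  · refine (hy (Metric.mem_closedBall_self hR0)).trans ?_
    by_cases hzt : P.h z = ⊤
    · show s x ≤ s z
      rw [hs, model_eq_top M _ _ x hzt]
      exact le_top
    · show s x ≤ s z
      rw [hs, hS.model_eq_coe M _ _ x hx, hS.model_eq_coe M _ _ x hzt, EReal.coe_le_coe_iff]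
      have h1 := hc z hzt
      have h2 := hS.f_g_le x z
      have h3 : R < ‖z - x‖ := by simpa [dist_eq_norm] using hz
      have h4 : b / a < ‖z - x‖ ^ 2 := by
        rw [← Real.sq_sqrt (show 0 ≤ b / a by positivity)]
        gcongr
      rw [div_lt_iff₀ ha0] at h4
      simp only [sub_self, map_zero, add_zero, norm_zero]
      rw [ha, hb] at h4
      nlinarith

theorem Standing.h_midpoint_le (hS : P.Standing lf lg Lg) {x y : Vec n} (hx : P.h x ≠ ⊤)
    (hy : P.h y ≠ ⊤) : P.h ((2⁻¹ : ℝ) • x + (2⁻¹ : ℝ) • y) ≤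
      ((2⁻¹ * (P.h x).toReal + 2⁻¹ * (P.h y).toReal : ℝ) : EReal) := by
  have h1 : (x, (P.h x).toReal) ∈ {p : Vec n × ℝ | P.h p.1 ≤ (p.2 : EReal)} :=
    (hS.coe_toReal_h hx).le
  have h2 : (y, (P.h y).toReal) ∈ {p : Vec n × ℝ | P.h p.1 ≤ (p.2 : EReal)} :=
    (hS.coe_toReal_h hy).le
  exact hS.convex_h h1 h2 (by norm_num) (by norm_num) (by norm_num : (2⁻¹ : ℝ) + 2⁻¹ = 1)

/-- Values of the exact step: sufficient decrease from strong convexity. -/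
theorem Standing.proxStep_decrease (hS : P.Standing lf lg Lg) {M c : ℝ}
    (hM : 2 * (lf : ℝ) * Lg < M) (hc : ∀ y, P.h y ≠ ⊤ → c ≤ P.f (P.g y) + (P.h y).toReal)
    {x : Vec n} (hx : P.h x ≠ ⊤) :
    P.h (P.proxStep M x) ≠ ⊤ ∧
      P.f (P.g x + P.jac x (P.proxStep M x - x)) + (P.h (P.proxStep M x)).toReal +
        3 * M / 4 * ‖P.proxStep M x - x‖ ^ 2 ≤ P.f (P.g x) + (P.h x).toReal := by
  have hmin := hS.proxStep_le hM hc hx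
  set y := P.proxStep M x with hy
  have hyt : P.h y ≠ ⊤ := by
    intro h
    have h1 := hmin x
    rw [model_eq_top M _ _ x h, hS.model_eq_coe M _ _ x hx] at h1
    exact EReal.coe_ne_top _ (top_le_iff.1 h1)
  refine ⟨hyt, ?_⟩
  -- Comparing the minimizer with the midpoint alone gives `3M/4`: the quadratic term drops from
  -- `M/2` to `M/8`, and the difference is doubled.
  set z := (2⁻¹ : ℝ) • x + (2⁻¹ : ℝ) • y with hz
  have hhz := hS.h_midpoint_le hx hyt
  have hzt : P.h z ≠ ⊤ := fun h => by
    rw [← hz, h] at hhz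
    exact EReal.coe_ne_top _ (top_le_iff.1 hhz)
  have h1 := hmin z
  rw [hS.model_eq_coe M _ _ x hyt, hS.model_eq_coe M _ _ x hzt, EReal.coe_le_coe_iff] at h1
  rw [← hz, hS.coe_toReal_h hzt, EReal.coe_le_coe_iff] at hhz
  have hzx : z - x = (2⁻¹ : ℝ) • (y - x) := by rw [hz]; module
  have h2 : P.f (P.g x + P.jac x (z - x)) ≤
      2⁻¹ * P.f (P.g x) + 2⁻¹ * P.f (P.g x + P.jac x (y - x)) := by
    have h3 := hS.convex_f.2 (Set.mem_univ (P.g x)) (Set.mem_univ (P.g x + P.jac x (y - x)))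
      (by norm_num) (by norm_num) (by norm_num : (2⁻¹ : ℝ) + 2⁻¹ = 1)
    have h4 : P.g x + P.jac x (z - x) =
        (2⁻¹ : ℝ) • P.g x + (2⁻¹ : ℝ) • (P.g x + P.jac x (y - x)) := by
      rw [hzx, map_smul]; module
    rw [h4]
    exact h3
  have h5 : ‖z - x‖ ^ 2 = ‖y - x‖ ^ 2 / 4 := by
    rw [hzx, norm_smul]
    norm_num
    ring
  rw [h5] at h1
  nlinarith

theorem Standing.f_affine_le (hS : P.Standing lf lg Lg) {u u' : Vec m}
    {J J' : Vec n →L[ℝ] Vec m} {tg tJ : ℝ} (hu : ‖u - u'‖ ≤ tg) (hJ : ‖J - J'‖ ≤ tJ) (w : Vec n) :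
    P.f (u + J w) ≤ P.f (u' + J' w) + lf * (tg + tJ * ‖w‖) := by
  have h1 := hS.f_le (u + J w) (u' + J' w)
  have h2 : ‖u + J w - (u' + J' w)‖ ≤ tg + tJ * ‖w‖ := by
    have h3 : u + J w - (u' + J' w) = (u - u') + (J - J') w := by
      rw [sub_apply]; abel
    rw [h3]
    refine (norm_add_le _ _).trans (add_le_add hu ?_)
    exact (J - J').le_of_opNorm_le hJ w
  have h4 : (lf : ℝ) * ‖u + J w - (u' + J' w)‖ ≤ lf * (tg + tJ * ‖w‖) := by gcongr
  linarith

/-- One inexact step on an inexact model decreases the objective up to the errors. -/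
theorem Standing.descent (hS : P.Standing lf lg Lg) {M c : ℝ} (hM : 5 * (lf : ℝ) * Lg < M)
    (hc : ∀ y, P.h y ≠ ⊤ → c ≤ P.f (P.g y) + (P.h y).toReal) {x : Vec n} (hx : P.h x ≠ ⊤)
    {u : Vec m} {J : Vec n →L[ℝ] Vec m} {tg tJ εbar : ℝ} (hu : ‖u - P.g x‖ ≤ tg)
    (hJ : ‖J - P.jac x‖ ≤ tJ) {x' : Vec n}
    (hx' : P.model M u J x x' ≤ (⨅ y, P.model M u J x y) + (εbar : EReal)) :
    P.h x' ≠ ⊤ ∧ P.f (P.g x') + (P.h x').toReal + (8 * M)⁻¹ * ‖P.genGrad M x‖ ^ 2 ≤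
      P.f (P.g x) + (P.h x).toReal + (2 * lf * tg + 3 * lf ^ 2 * tJ ^ 2 / M + εbar) := by
  have hlL : 0 ≤ (lf : ℝ) * Lg := by positivity
  have hM0 : 0 < M := by linarith
  obtain ⟨hyt, hdec⟩ := hS.proxStep_decrease (M := M) (by linarith) hc hx
  have hG : ‖P.genGrad M x‖ ^ 2 = M ^ 2 * ‖P.proxStep M x - x‖ ^ 2 := by
    rw [genGrad, norm_smul, mul_pow, Real.norm_eq_abs, sq_abs, norm_sub_rev]
  rw [hG]
  set y := P.proxStep M x with hy
  have h1 : P.model M u J x x' ≤ P.model M u J x y + (εbar : EReal) :=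
    hx'.trans (by gcongr; exact iInf_le _ y)
  rw [hS.model_eq_coe M _ _ x hyt, ← EReal.coe_add] at h1
  have hxt : P.h x' ≠ ⊤ := fun h => by
    rw [model_eq_top M _ _ x h] at h1
    exact EReal.coe_ne_top _ (top_le_iff.1 h1)
  refine ⟨hxt, ?_⟩
  rw [hS.model_eq_coe M _ _ x hxt, EReal.coe_le_coe_iff] at h1
  have h2 := hS.f_g_le x x'
  have h3 := hS.f_affine_le hu hJ (y - x)
  have hu' : ‖P.g x - u‖ ≤ tg := by rwa [norm_sub_rev]
  have hJ' : ‖P.jac x - J‖ ≤ tJ := by rwa [norm_sub_rev]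
  have h4 := hS.f_affine_le hu' hJ' (x' - x)
  set D := ‖y - x‖ with hD
  set d := ‖x' - x‖ with hd
  have h5 : M ^ 2 * D ^ 2 * (8 * M)⁻¹ = M / 8 * D ^ 2 := by field_simp
  -- The budget: the exact step leaves `-M/4 · D²`, of which Young's inequality spends `M/8`,
  -- keeping the claimed decrease. In `d²`, the costs `M/4` and `M/5` (linearization) fit in the
  -- `M/2` of the inexact model.
  have h6 : (lf : ℝ) * tJ * D ≤ M / 8 * D ^ 2 + 2 * lf ^ 2 * tJ ^ 2 / M := by
    have : M / 8 * D ^ 2 + 2 * lf ^ 2 * tJ ^ 2 / M - lf * tJ * D =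
      (M * D - 4 * (lf * tJ)) ^ 2 / (8 * M) := by field_simp; ring
    have h0 : 0 ≤ (M * D - 4 * (lf * tJ)) ^ 2 / (8 * M) := by positivity
    linarith
  have h7 : (lf : ℝ) * tJ * d ≤ M / 4 * d ^ 2 + lf ^ 2 * tJ ^ 2 / M := by
    have : M / 4 * d ^ 2 + lf ^ 2 * tJ ^ 2 / M - lf * tJ * d =
      (M * d - 2 * (lf * tJ)) ^ 2 / (4 * M) := by field_simp; ring
    have h0 : 0 ≤ (M * d - 2 * (lf * tJ)) ^ 2 / (4 * M) := by positivity
    linarith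
  have h8 : (lf : ℝ) * Lg * d ^ 2 ≤ M / 5 * d ^ 2 := by gcongr; linarith
  have h9 : 3 * (lf : ℝ) ^ 2 * tJ ^ 2 / M = 2 * lf ^ 2 * tJ ^ 2 / M + lf ^ 2 * tJ ^ 2 / M := by
    ring
  have h10 : 0 ≤ M * d ^ 2 := by positivity
  rw [mul_comm, h5, h9]
  linarith

end Problem

/-! ### Measurability and the mini-batch estimators -/

theorem measurable_clm_of_apply {α : Type*} [MeasurableSpace α] {n m : ℕ}
    {f : α → (Vec n →L[ℝ] Vec m)} (hf : ∀ v, Measurable fun a => f a v) : Measurable f := by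
  have h : f = fun a => ∑ i : Fin n, ContinuousLinearMap.smulRightL ℝ (Vec n) (Vec m)
      (EuclideanSpace.proj i) (f a (EuclideanSpace.single i 1)) := by
    funext a
    ext v : 1
    have hv : v = ∑ i, v i • EuclideanSpace.single i (1 : ℝ) := by
      ext j
      simp [Finset.sum_apply, Pi.single_apply]
    conv_lhs => rw [hv]
    simp
  rw [h]
  exact Finset.measurable_fun_sum _ fun i _ =>
    (ContinuousLinearMap.continuous _).measurable.comp (hf _)

namespace Problem

variable {n m : ℕ} {Ξ : Type*} [MeasurableSpace Ξ] {P : Problem n m Ξ} {lf lg Lg : ℝ≥0}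

theorem Standing.measurable_G_uncurry (hS : P.Standing lf lg Lg) :
    Measurable fun p : Vec n × Ξ => P.G p.2 p.1 :=
  measurable_uncurry_of_continuous_of_measurable (u := fun x ξ => P.G ξ x)
    (fun ξ => (hS.differentiable_G ξ).continuous) hS.measurable_G

/-- Each directional derivative is a pointwise limit of difference quotients of `G`, which is
jointly measurable as a Carathéodory function. -/
theorem Standing.measurable_fderiv_uncurry (hS : P.Standing lf lg Lg) :
    Measurable fun p : Vec n × Ξ => fderiv ℝ (P.G p.2) p.1 := by
  refine measurable_clm_of_apply fun v => ?_
  refine measurable_of_tendsto_metrizable (f := fun (k : ℕ) (p : Vec n × Ξ) =>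
    (k : ℝ) • (P.G p.2 (p.1 + (k : ℝ)⁻¹ • v) - P.G p.2 p.1)) (fun k => ?_) ?_
  · have h1 : Measurable fun p : Vec n × Ξ => P.G p.2 (p.1 + (k : ℝ)⁻¹ • v) :=
      hS.measurable_G_uncurry.comp (Measurable.prodMk (measurable_fst.add_const _) measurable_snd)
    exact (h1.sub hS.measurable_G_uncurry).const_smul (k : ℝ)
  · rw [tendsto_pi_nhds]
    intro p
    have h := ((hS.differentiable_G p.2) p.1).hasFDerivAt
    have hlim := h.lim v (c := fun k : ℕ => (k : ℝ)) (l := Filter.atTop) (𝕜 := ℝ)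
      (by simpa using tendsto_natCast_atTop_atTop (R := ℝ))
    exact hlim

theorem Standing.continuous_g (hS : P.Standing lf lg Lg) : Continuous P.g :=
  hS.differentiable_g.continuous

theorem Standing.continuous_jac (hS : P.Standing lf lg Lg) : Continuous P.jac :=
  hS.lipschitz_jac.continuous

/-- Differentiation under the integral: almost every `g_ξ` has Lipschitz constant at most `σJ + lg`.
The constant `lg` serves only here, which is why no batch size depends on it. -/
theorem Standing.integral_fderiv_eq (hS : P.Standing lf lg Lg) [IsProbabilityMeasure P.D]
    {σg σJ : ℝ} (hV : P.UniformVariance σg σJ) (x : Vec n) :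
    ∫ ξ, fderiv ℝ (P.G ξ) x ∂P.D = P.jac x := by
  have hmeas : Measurable fun ξ => fderiv ℝ (P.G ξ) x :=
    hS.measurable_fderiv_uncurry.comp measurable_prodMk_left
  have h := hasFDerivAt_integral_of_dominated_loc_of_lip (𝕜 := ℝ) (μ := P.D)
    (F := fun y ξ => P.G ξ y) (F' := fun ξ => fderiv ℝ (P.G ξ) x) (x₀ := x)
    (bound := fun _ => |σJ + lg|) (s := Set.univ) Filter.univ_mem
    (Filter.Eventually.of_forall fun y => (hS.integrable_G y).aestronglyMeasurable)
    (hS.integrable_G x) hmeas.aestronglyMeasurable ?_ (integrable_const _)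
    (Filter.Eventually.of_forall fun ξ => (hS.differentiable_G ξ x).hasFDerivAt)
  · exact h.2.fderiv.symm
  · filter_upwards [hV] with ξ hξ
    refine LipschitzWith.lipschitzOnWith ?_
    refine lipschitzWith_of_nnnorm_fderiv_le (𝕜 := ℝ) (hS.differentiable_G ξ) fun y => ?_
    rw [← NNReal.coe_le_coe, coe_nnnorm, Real.coe_nnabs, abs_abs]
    have h1 : ‖P.jac y‖ ≤ lg := norm_fderiv_le_of_lipschitz ℝ hS.lipschitz_g
    have h2 := (hξ y).2
    have h3 : ‖fderiv ℝ (P.G ξ) y‖ ≤ ‖fderiv ℝ (P.G ξ) y - P.jac y‖ + ‖P.jac y‖ := by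
      simpa using norm_add_le (fderiv ℝ (P.G ξ) y - P.jac y) (P.jac y)
    exact (by linarith : _ ≤ σJ + (lg : ℝ)).trans (le_abs_self _)

theorem inv_smul_sum_sub {N : ℕ} (hN : 0 < N) {W : Type*} [AddCommGroup W] [Module ℝ W]
    (v : Fin N → W) (w : W) :
    (N : ℝ)⁻¹ • ∑ r, (v r - w) = (N : ℝ)⁻¹ • ∑ r, v r - w := by
  have : (N : ℝ) ≠ 0 := by positivity
  rw [Finset.sum_sub_distrib, smul_sub]
  congr 1
  simp [← Nat.cast_smul_eq_nsmul ℝ, smul_smul, this]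

theorem Standing.measure_jac_batch_gt_le (hS : P.Standing lf lg Lg) [IsProbabilityMeasure P.D]
    {σg σJ : ℝ} (hV : P.UniformVariance σg σJ) {σ : ℝ} (hσ : 0 < σ) (hσJ : σJ ≤ σ) (x : Vec n)
    {p N : ℕ} (hp : 0 < p) (hN : 0 < N) {t : ℝ} (ht : 0 < t)
    (h : 4 * Real.exp 3 * p * σ ^ 2 ≤ N * t ^ 2) :
    (Measure.pi fun _ : Fin N => P.D).real
      {b | t < ‖(N : ℝ)⁻¹ • ∑ r, fderiv ℝ (P.G (b r)) x - P.jac x‖} ≤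
      (m + n) * Real.exp (-p) := by
  have hmeas : Measurable fun ξ => fderiv ℝ (P.G ξ) x :=
    hS.measurable_fderiv_uncurry.comp measurable_prodMk_left
  have hb : ∀ᵐ ξ ∂P.D, ‖fderiv ℝ (P.G ξ) x - P.jac x‖ ≤ σ := by
    filter_upwards [hV] with ξ hξ using ((hξ x).2).trans hσJ
  have hsm : StronglyMeasurable fun ξ => fderiv ℝ (P.G ξ) x - P.jac x :=
    (hmeas.sub_const _).stronglyMeasurable
  have hint : Integrable (fun ξ => fderiv ℝ (P.G ξ) x) P.D := by
    have h1 := (Integrable.of_bound hsm.aestronglyMeasurable σ hb).add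
      (integrable_const (P.jac x))
    exact h1.congr (Filter.Eventually.of_forall fun ξ => by simp)
  have h0 : ∫ ξ, (fderiv ℝ (P.G ξ) x - P.jac x) ∂P.D = 0 := by
    rw [integral_sub hint (integrable_const _), hS.integral_fderiv_eq hV]
    simp
  have hmain := measure_norm_mean_gt_le hsm hσ hb h0 hp hN ht h
  simp only [inv_smul_sum_sub hN, finrank_euclideanSpace, Fintype.card_fin] at hmain
  rwa [add_comm (n : ℝ)] at hmain

theorem Standing.measure_g_batch_gt_le (hS : P.Standing lf lg Lg) [IsProbabilityMeasure P.D]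
    {σg σJ : ℝ} (hV : P.UniformVariance σg σJ) {σ : ℝ} (hσ : 0 < σ) (hσg : σg ≤ σ) (x : Vec n)
    {p N : ℕ} (hp : 0 < p) (hN : 0 < N) {t : ℝ} (ht : 0 < t)
    (h : 4 * Real.exp 3 * p * σ ^ 2 ≤ N * t ^ 2) :
    (Measure.pi fun _ : Fin N => P.D).real
      {a | t < ‖(N : ℝ)⁻¹ • ∑ r, P.G (a r) x - P.g x‖} ≤ (m + 1) * Real.exp (-p) := by
  -- Vectors are embedded isometrically as operators from `ℝ`, so the operator bound applies with
  -- dimension `m + 1`.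
  set L : Vec m →L[ℝ] (ℝ →L[ℝ] Vec m) :=
    ContinuousLinearMap.smulRightL ℝ ℝ (Vec m) (ContinuousLinearMap.id ℝ ℝ) with hL
  have hLn : ∀ v, ‖L v‖ = ‖v‖ := fun v => by simp [hL]
  have hb : ∀ᵐ ξ ∂P.D, ‖L (P.G ξ x - P.g x)‖ ≤ σ := by
    filter_upwards [hV] with ξ hξ
    rw [hLn]
    exact ((hξ x).1).trans hσg
  have hsm : StronglyMeasurable fun ξ => L (P.G ξ x - P.g x) :=
    L.continuous.comp_stronglyMeasurable (((hS.measurable_G x).sub_const _).stronglyMeasurable)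
  have hint : Integrable (fun ξ => P.G ξ x - P.g x) P.D :=
    (hS.integrable_G x).sub (integrable_const (P.g x))
  have h0 : ∫ ξ, L (P.G ξ x - P.g x) ∂P.D = 0 := by
    rw [L.integral_comp_comm hint, integral_sub (hS.integrable_G x) (integrable_const _)]
    simp [g]
  have hmain := measure_norm_mean_gt_le hsm hσ hb h0 hp hN ht h
  simp only [← map_sum, ← map_smul, hLn, inv_smul_sum_sub hN, finrank_euclideanSpace,
    Fintype.card_fin, Module.finrank_self, Nat.cast_one] at hmain
  rwa [add_comm (1 : ℝ)] at hmain

theorem Standing.measurable_model (hS : P.Standing lf lg Lg) (M : ℝ) :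
    Measurable fun q : (Vec m × (Vec n →L[ℝ] Vec m) × Vec n) × Vec n =>
      P.model M q.1.1 q.1.2.1 q.1.2.2 q.2 := by
  unfold model
  have hf : Continuous P.f := hS.lipschitz_f.continuous
  refine (Measurable.add ?_ (hS.closed_h.measurable.comp measurable_snd)).add ?_
  · exact (continuous_coe_real_ereal.comp (by fun_prop)).measurable
  · exact (continuous_coe_real_ereal.comp (by fun_prop)).measurable

/-- The infimum is uncountable, but for fixed `y` the model is continuous in its parameters or
identically `⊤`; an infimum of such functions is upper semicontinuous. -/
theorem Standing.measurable_iInf_model (hS : P.Standing lf lg Lg) (M : ℝ) :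
    Measurable fun q : Vec m × (Vec n →L[ℝ] Vec m) × Vec n =>
      ⨅ y, P.model M q.1 q.2.1 q.2.2 y := by
  refine UpperSemicontinuous.measurable (upperSemicontinuous_iInf fun y => ?_)
  have hf : Continuous P.f := hS.lipschitz_f.continuous
  by_cases hy : P.h y = ⊤
  · simp only [model_eq_top M _ _ _ hy]
    exact upperSemicontinuous_const
  · simp only [hS.model_eq_coe M _ _ _ hy]
    exact (continuous_coe_real_ereal.comp (by fun_prop)).upperSemicontinuous

end Problem

/-! ### The randomness of a run -/

theorem measure_prod_le_of_section_le {α β : Type*} [MeasurableSpace α] [MeasurableSpace β]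
    {μ : Measure α} [IsProbabilityMeasure μ] {ν : Measure β} [SFinite ν] {s : Set (α × β)}
    (hs : MeasurableSet s) {c : ENNReal} (hc : ∀ a, ν (Prod.mk a ⁻¹' s) ≤ c) :
    μ.prod ν s ≤ c := by
  rw [Measure.prod_apply hs]
  calc ∫⁻ a, ν (Prod.mk a ⁻¹' s) ∂μ ≤ ∫⁻ _, c ∂μ := lintegral_mono hc
    _ = c := by simp

/-- Resampling one coordinate independently preserves the product law, as is checked on finite
boxes. This takes the place of conditioning on the past. -/
theorem measurePreserving_update_infinitePi {ι X : Type*} [DecidableEq ι] [MeasurableSpace X]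
    (ρ : Measure X) [IsProbabilityMeasure ρ] (j : ι) :
    MeasurePreserving (fun p : (ι → X) × X => Function.update p.1 j p.2)
      ((Measure.infinitePi fun _ : ι => ρ).prod ρ) (Measure.infinitePi fun _ : ι => ρ) := by
  have hmeas : Measurable fun p : (ι → X) × X => Function.update p.1 j p.2 := measurable_update'
  refine ⟨hmeas, Measure.eq_infinitePi _ fun s t ht => ?_⟩
  rw [Measure.map_apply hmeas (MeasurableSet.pi s.countable_toSet fun i _ => ht i)]
  by_cases hj : j ∈ s
  · have h : (fun p : (ι → X) × X => Function.update p.1 j p.2) ⁻¹' ((s : Set ι).pi t) =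
        (((s.erase j : Finset ι) : Set ι).pi t) ×ˢ t j := by
      ext ⟨ω, w⟩
      simp only [Set.mem_preimage, Set.mem_pi, Set.mem_prod, Finset.mem_coe, Finset.mem_erase]
      constructor
      · intro h
        refine ⟨fun i hi => ?_, ?_⟩
        · have := h i hi.2
          rwa [Function.update_of_ne hi.1] at this
        · simpa using h j hj
      · rintro ⟨h1, h2⟩ i hi
        rcases eq_or_ne i j with rfl | hij
        · simpa using h2
        · rw [Function.update_of_ne hij]
          exact h1 i ⟨hij, hi⟩
    rw [h, Measure.prod_prod, Measure.infinitePi_pi _ fun i _ => ht i, Finset.prod_erase_mul _ _ hj]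
  · have h : (fun p : (ι → X) × X => Function.update p.1 j p.2) ⁻¹' ((s : Set ι).pi t) =
        ((s : Set ι).pi t) ×ˢ Set.univ := by
      ext ⟨ω, w⟩
      simp only [Set.mem_preimage, Set.mem_pi, Set.mem_prod, Finset.mem_coe, Set.mem_univ, and_true]
      refine forall₂_congr fun i hi => ?_
      rw [Function.update_of_ne (fun h : i = j => hj (by rw [← h]; exact hi))]
    rw [h, Measure.prod_prod, Measure.infinitePi_pi _ fun i _ => ht i, measure_univ, mul_one]

/-- An event about the coordinate `j` and a quantity that does not depend on it. -/
theorem infinitePi_measure_le_of_section_le {ι X W : Type*} [DecidableEq ι] [MeasurableSpace X]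
    [MeasurableSpace W] (ρ : Measure X) [IsProbabilityMeasure ρ] (j : ι) {Y : (ι → X) → W}
    (hY : Measurable Y) (hj : ∀ ω w, Y (Function.update ω j w) = Y ω) {s : Set (W × X)}
    (hs : MeasurableSet s) {c : ENNReal} (hc : ∀ y, ρ (Prod.mk y ⁻¹' s) ≤ c) :
    (Measure.infinitePi fun _ : ι => ρ) {ω | (Y ω, ω j) ∈ s} ≤ c := by
  have hs' : MeasurableSet {ω : ι → X | (Y ω, ω j) ∈ s} :=
    (hY.prodMk (measurable_pi_apply j)) hs
  rw [← (measurePreserving_update_infinitePi ρ j).measure_preimage hs'.nullMeasurableSet]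
  have h : (fun p : (ι → X) × X => Function.update p.1 j p.2) ⁻¹' {ω | (Y ω, ω j) ∈ s} =
      {p | (Y p.1, p.2) ∈ s} := by
    ext ⟨ω, w⟩
    simp [hj]
  rw [h]
  exact measure_prod_le_of_section_le (((hY.comp measurable_fst).prodMk measurable_snd) hs)
    fun ω => hc (Y ω)

namespace Problem

variable {n m : ℕ} {Ξ S : Type*} [MeasurableSpace Ξ] {P : Problem n m Ξ}
  {lf lg Lg : ℝ≥0}

theorem miniBatch_val (P : Problem n m Ξ) {A B : ℕ} (a : Fin A → Ξ) (b : Fin B → Ξ) (x : Vec n) :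
    (P.miniBatch a b x).val = ((A : ℝ)⁻¹ • ∑ r, P.G (a r) x,
      (B : ℝ)⁻¹ • ∑ r, fderiv ℝ (P.G (b r)) x) := rfl

theorem Standing.measurable_miniBatch [MeasurableSpace S] (hS : P.Standing lf lg Lg) (A B : ℕ) :
    Measurable fun p : Vec n × Draw Ξ S A B => (P.miniBatch p.2.1 p.2.2.1 p.1).val := by
  simp only [miniBatch_val]
  refine Measurable.prodMk ?_ ?_
  · have h : Measurable fun p : Vec n × Draw Ξ S A B => ∑ r, P.G (p.2.1 r) p.1 :=
      Finset.measurable_fun_sum _ fun r _ => hS.measurable_G_uncurry.comp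
        (measurable_fst.prodMk ((measurable_pi_apply r).comp (measurable_fst.comp measurable_snd)))
    exact h.const_smul (A : ℝ)⁻¹
  · have h : Measurable fun p : Vec n × Draw Ξ S A B => ∑ r, fderiv ℝ (P.G (p.2.2.1 r)) p.1 :=
      Finset.measurable_fun_sum _ fun r _ => hS.measurable_fderiv_uncurry.comp
        (measurable_fst.prodMk ((measurable_pi_apply r).comp
          (measurable_fst.comp (measurable_snd.comp measurable_snd))))
    exact h.const_smul (B : ℝ)⁻¹

/-- The draw `w` gives accurate estimates at `x` and the solver succeeds on the model. -/
def GoodDraw (P : Problem n m Ξ) (M : ℝ) (solver : Solver n S) (εbar δbar tg tJ : ℝ) {A B : ℕ}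
    (x : Vec n) (w : Draw Ξ S A B) : Prop :=
  ‖(P.miniBatch w.1 w.2.1 x).val.1 - P.g x‖ ≤ tg ∧
  ‖(P.miniBatch w.1 w.2.1 x).val.2 - P.jac x‖ ≤ tJ ∧
  P.model M (P.miniBatch w.1 w.2.1 x).val.1 (P.miniBatch w.1 w.2.1 x).val.2 x
      (P.step M solver εbar δbar w x).val ≤
    (⨅ y, P.model M (P.miniBatch w.1 w.2.1 x).val.1 (P.miniBatch w.1 w.2.1 x).val.2 x y) +
      (εbar : EReal)

/-! ### Measurability of one step and the probability of a bad draw -/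

section Measurability

variable [MeasurableSpace S] {M : ℝ} {ν : Measure S} {solver : Solver n S} {εbar δbar : ℝ}

theorem Standing.measurableSet_solver_success (hS : P.Standing lf lg Lg)
    (hsol : P.SolverAssumption M ν solver) (hε : 0 < εbar) (hδ : 0 < δbar) :
    MeasurableSet {p : (Vec m × (Vec n →L[ℝ] Vec m) × Vec n) × S |
      P.model M p.1.1 p.1.2.1 p.1.2.2
        (solver (P.model M p.1.1 p.1.2.1 p.1.2.2) εbar δbar p.2) ≤
      (⨅ y, P.model M p.1.1 p.1.2.1 p.1.2.2 y) + (εbar : EReal)} := by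
  have h1 : Measurable fun p : (Vec m × (Vec n →L[ℝ] Vec m) × Vec n) × S =>
      (p.1, solver (P.model M p.1.1 p.1.2.1 p.1.2.2) εbar δbar p.2) :=
    measurable_fst.prodMk (hsol.measurable εbar δbar hε hδ)
  have h2 : Measurable fun p : (Vec m × (Vec n →L[ℝ] Vec m) × Vec n) × S =>
      ⨅ y, P.model M p.1.1 p.1.2.1 p.1.2.2 y := (hS.measurable_iInf_model M).comp measurable_fst
  have h3 := (hS.measurable_model M).comp h1
  exact measurableSet_le h3 (h2.add_const _)

theorem Standing.measurable_model_args (hS : P.Standing lf lg Lg) (A B : ℕ) :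
    Measurable fun p : Vec n × Draw Ξ S A B =>
      ((((P.miniBatch p.2.1 p.2.2.1 p.1).val.1, (P.miniBatch p.2.1 p.2.2.1 p.1).val.2, p.1),
        p.2.2.2) : (Vec m × (Vec n →L[ℝ] Vec m) × Vec n) × S) := by
  have h := hS.measurable_miniBatch (S := S) A B
  have h3 : Measurable fun p : Vec n × Draw Ξ S A B => p.2.2.2 := measurable_snd.snd.snd
  exact (h.fst.prodMk (h.snd.prodMk measurable_fst)).prodMk h3

theorem Standing.measurable_step (hS : P.Standing lf lg Lg)
    (hsol : P.SolverAssumption M ν solver) (hε : 0 < εbar) (hδ : 0 < δbar) (A B : ℕ) :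
    Measurable fun p : Vec n × Draw Ξ S A B => (P.step M solver εbar δbar p.2 p.1).val := by
  have h := (hsol.measurable εbar δbar hε hδ).comp (hS.measurable_model_args A B)
  exact h

theorem Standing.measurableSet_goodDraw (hS : P.Standing lf lg Lg)
    (hsol : P.SolverAssumption M ν solver) (hε : 0 < εbar) (hδ : 0 < δbar) (tg tJ : ℝ) (A B : ℕ) :
    MeasurableSet {p : Vec n × Draw Ξ S A B |
      P.GoodDraw M solver εbar δbar tg tJ p.1 p.2} := by
  have h := hS.measurable_miniBatch (S := S) A B
  have hg : Measurable fun p : Vec n × Draw Ξ S A B => P.g p.1 :=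
    hS.continuous_g.measurable.comp measurable_fst
  have hJ : Measurable fun p : Vec n × Draw Ξ S A B => P.jac p.1 :=
    hS.continuous_jac.measurable.comp measurable_fst
  refine MeasurableSet.inter ?_ (MeasurableSet.inter ?_ ?_)
  · exact measurableSet_le (h.fst.sub hg).norm measurable_const
  · exact measurableSet_le (h.snd.sub hJ).norm measurable_const
  · have h3 := (hS.measurable_model_args A B) (hS.measurableSet_solver_success hsol hε hδ)
    exact h3

instance {D : Measure Ξ} [IsProbabilityMeasure D] [IsProbabilityMeasure ν] {A B : ℕ} :
    IsProbabilityMeasure (drawLaw D ν A B) := by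
  unfold drawLaw
  infer_instance

theorem Standing.solver_failure_le (hS : P.Standing lf lg Lg) [IsProbabilityMeasure ν]
    (hsol : P.SolverAssumption M ν solver) (hε : 0 < εbar) (hδ : 0 < δbar) (u : Vec m)
    (J : Vec n →L[ℝ] Vec m) (x : Vec n) :
    ν {ζ | ¬ P.model M u J x (solver (P.model M u J x) εbar δbar ζ) ≤
        (⨅ y, P.model M u J x y) + (εbar : EReal)} ≤ ENNReal.ofReal δbar := by
  have hm : MeasurableSet {ζ | P.model M u J x (solver (P.model M u J x) εbar δbar ζ) ≤
      (⨅ y, P.model M u J x y) + (εbar : EReal)} :=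
    (measurable_prodMk_left (x := (u, J, x))) (hS.measurableSet_solver_success hsol hε hδ)
  have h := prob_compl_eq_one_sub (μ := ν) hm
  rw [Set.compl_ofPred] at h
  rw [h, tsub_le_iff_right]
  calc (1 : ENNReal) = ENNReal.ofReal (δbar + (1 - δbar)) := by simp
    _ ≤ ENNReal.ofReal δbar + ENNReal.ofReal (1 - δbar) := ENNReal.ofReal_add_le
    _ ≤ _ := by gcongr; exact hsol.success εbar δbar hε hδ u J x

/-- A union bound over the three ways to fail. Once both batches are fixed the model is fixed, so
the solver's guarantee, valid for every model, applies to the independent seed. -/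
theorem Standing.drawLaw_not_goodDraw_le (hS : P.Standing lf lg Lg) [IsProbabilityMeasure P.D]
    [IsProbabilityMeasure ν] (hsol : P.SolverAssumption M ν solver) (hε : 0 < εbar)
    (hδ : 0 < δbar) {tg tJ : ℝ} {A B : ℕ} {x : Vec n} {c₁ c₂ : ℝ}
    (h₁ : (Measure.pi fun _ : Fin A => P.D).real
      {a | tg < ‖(A : ℝ)⁻¹ • ∑ r, P.G (a r) x - P.g x‖} ≤ c₁)
    (h₂ : (Measure.pi fun _ : Fin B => P.D).real
      {b | tJ < ‖(B : ℝ)⁻¹ • ∑ r, fderiv ℝ (P.G (b r)) x - P.jac x‖} ≤ c₂) :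
    drawLaw P.D ν A B {w | ¬ P.GoodDraw M solver εbar δbar tg tJ x w} ≤
      ENNReal.ofReal (c₁ + c₂ + δbar) := by
  have hc₁ := measureReal_nonneg.trans h₁
  have hc₂ := measureReal_nonneg.trans h₂
  set s₁ := {a : Fin A → Ξ | tg < ‖(A : ℝ)⁻¹ • ∑ r, P.G (a r) x - P.g x‖}
  set s₂ := {b : Fin B → Ξ | tJ < ‖(B : ℝ)⁻¹ • ∑ r, fderiv ℝ (P.G (b r)) x - P.jac x‖}
  set s₃ := {w : Draw Ξ S A B | ¬ P.model M (P.miniBatch w.1 w.2.1 x).val.1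
    (P.miniBatch w.1 w.2.1 x).val.2 x (P.step M solver εbar δbar w x).val ≤
    (⨅ y, P.model M (P.miniBatch w.1 w.2.1 x).val.1 (P.miniBatch w.1 w.2.1 x).val.2 x y) +
      (εbar : EReal)} with hs₃
  have hx : Measurable fun w : Draw Ξ S A B => (x, w) := measurable_prodMk_left
  have hs₃m : MeasurableSet s₃ := by
    have h := (hS.measurable_model_args A B) (hS.measurableSet_solver_success hsol hε hδ)
    have h' := (hx h).compl
    exact h'
  have hsub : {w : Draw Ξ S A B | ¬ P.GoodDraw M solver εbar δbar tg tJ x w} ⊆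
      (s₁ ×ˢ Set.univ) ∪ (Set.univ ×ˢ (s₂ ×ˢ Set.univ)) ∪ s₃ := by
    intro w hw
    by_contra hcon
    simp only [Set.mem_union, not_or] at hcon
    obtain ⟨⟨h1, h2⟩, h3⟩ := hcon
    refine hw ⟨?_, ?_, not_not.1 h3⟩
    · have h1' : w.1 ∉ s₁ := fun h => h1 ⟨h, trivial⟩
      exact not_lt.1 h1'
    · have h2' : w.2.1 ∉ s₂ := fun h => h2 ⟨trivial, h, trivial⟩
      exact not_lt.1 h2'
  have h₁' : drawLaw P.D ν A B (s₁ ×ˢ Set.univ) ≤ ENNReal.ofReal c₁ := by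
    unfold drawLaw
    rw [Measure.prod_prod, measure_univ, mul_one]
    exact (ENNReal.le_ofReal_iff_toReal_le (measure_ne_top _ _) hc₁).2 h₁
  have h₂' : drawLaw P.D ν A B (Set.univ ×ˢ (s₂ ×ˢ Set.univ)) ≤ ENNReal.ofReal c₂ := by
    unfold drawLaw
    rw [Measure.prod_prod, Measure.prod_prod, measure_univ, measure_univ, mul_one, one_mul]
    exact (ENNReal.le_ofReal_iff_toReal_le (measure_ne_top _ _) hc₂).2 h₂
  have h₃' : drawLaw P.D ν A B s₃ ≤ ENNReal.ofReal δbar := by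
    unfold drawLaw
    refine measure_prod_le_of_section_le hs₃m fun a => ?_
    refine measure_prod_le_of_section_le (hs₃m.preimage measurable_prodMk_left) fun b => ?_
    have h := hS.solver_failure_le hsol hε hδ (P.miniBatch a b x).val.1
      (P.miniBatch a b x).val.2 x
    exact h
  refine (measure_mono hsub).trans ((measure_union_le _ _).trans ?_)
  rw [ENNReal.ofReal_add (by positivity) hδ.le, ENNReal.ofReal_add hc₁ hc₂]
  exact add_le_add ((measure_union_le _ _).trans (add_le_add h₁' h₂')) h₃'

end Measurability

/-! ### Iterates as functions of the past draws, and oracle counts -/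

section Iterates

variable (P) (M : ℝ) (solver : Solver n S) (εbar δbar : ℝ) {A B : ℕ} (x₀ : Vec n) (τ : ℕ → ℕ)

theorem epoch_congr {ω ω' : ℕ × ℕ → Draw Ξ S A B} (k : ℕ) (start : Counted (Vec n)) (i : ℕ)
    (h : ∀ i' < i, ω (k, i') = ω' (k, i')) :
    P.epoch M solver εbar δbar ω k start i = P.epoch M solver εbar δbar ω' k start i := by
  induction i with
  | zero => rfl
  | succ i ih =>
    simp only [epoch]
    rw [ih fun i' hi' => h i' (by omega), h i (by omega)]

theorem run_congr {ω ω' : ℕ × ℕ → Draw Ξ S A B} (k : ℕ)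
    (h : ∀ k' < k, ∀ i, ω (k', i) = ω' (k', i)) :
    P.run M solver εbar δbar ω x₀ τ k = P.run M solver εbar δbar ω' x₀ τ k := by
  induction k with
  | zero => rfl
  | succ k ih =>
    simp only [run]
    rw [ih fun k' hk' => h k' (by omega)]
    exact epoch_congr P M solver εbar δbar k _ _ fun i' _ => h k (by omega) i'

/-- The iterate at `(k, i)` uses only draws that precede `(k, i)`, so the draw made there is fresh.
-/
theorem iterate_update (ω : ℕ × ℕ → Draw Ξ S A B) (k i : ℕ) (w : Draw Ξ S A B) :
    P.iterate M solver εbar δbar (Function.update ω (k, i) w) x₀ τ k i =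
      P.iterate M solver εbar δbar ω x₀ τ k i := by
  unfold iterate
  rw [P.run_congr M solver εbar δbar x₀ τ (ω' := ω) k fun k' hk' i' => ?_,
    P.epoch_congr M solver εbar δbar (ω' := ω) k _ i fun i' hi' => ?_]
  · exact Function.update_of_ne (by simp; omega) _ _
  · exact Function.update_of_ne (by simp; omega) _ _

theorem iterate_zero_zero (ω : ℕ × ℕ → Draw Ξ S A B) :
    P.iterate M solver εbar δbar ω x₀ τ 0 0 = x₀ := rfl

theorem iterate_succ (ω : ℕ × ℕ → Draw Ξ S A B) (k i : ℕ) :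
    P.iterate M solver εbar δbar ω x₀ τ k (i + 1) =
      (P.step M solver εbar δbar (ω (k, i)) (P.iterate M solver εbar δbar ω x₀ τ k i)).val := rfl

theorem iterate_epoch_succ (ω : ℕ × ℕ → Draw Ξ S A B) (k : ℕ) :
    P.iterate M solver εbar δbar ω x₀ τ (k + 1) 0 =
      P.iterate M solver εbar δbar ω x₀ τ k (τ k) := rfl

variable {P M solver εbar δbar} in
theorem measurable_iterate [MeasurableSpace S]
    (hstep : Measurable fun p : Vec n × Draw Ξ S A B => (P.step M solver εbar δbar p.2 p.1).val)
    (k i : ℕ) : Measurable fun ω : ℕ × ℕ → Draw Ξ S A B =>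
      P.iterate M solver εbar δbar ω x₀ τ k i := by
  have inner : ∀ k, (Measurable fun ω : ℕ × ℕ → Draw Ξ S A B =>
      P.iterate M solver εbar δbar ω x₀ τ k 0) → ∀ i, Measurable fun ω : ℕ × ℕ → Draw Ξ S A B =>
      P.iterate M solver εbar δbar ω x₀ τ k i := by
    intro k h0 i
    induction i with
    | zero => exact h0
    | succ i ih =>
      simp only [iterate_succ]
      have h1 : Measurable fun ω : ℕ × ℕ → Draw Ξ S A B =>
          (P.iterate M solver εbar δbar ω x₀ τ k i, ω (k, i)) :=
        ih.prodMk (measurable_pi_apply (k, i))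
      have h2 := hstep.comp h1
      exact h2
  refine inner k ?_ i
  induction k with
  | zero =>
    simp only [iterate_zero_zero]
    exact measurable_const
  | succ k ih =>
    simp only [iterate_epoch_succ]
    exact inner k ih _

theorem step_gEvals (w : Draw Ξ S A B) (x : Vec n) :
    (P.step M solver εbar δbar w x).gEvals = A := by
  simp [step, miniBatch, Counted.bind, Counted.pure, Counted.mean, evalG, evalJac]

theorem step_jacEvals (w : Draw Ξ S A B) (x : Vec n) :
    (P.step M solver εbar δbar w x).jacEvals = B := by
  simp [step, miniBatch, Counted.bind, Counted.pure, Counted.mean, evalG, evalJac]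

theorem epoch_evals (ω : ℕ × ℕ → Draw Ξ S A B) (k : ℕ) (start : Counted (Vec n)) (i : ℕ) :
    (P.epoch M solver εbar δbar ω k start i).gEvals = start.gEvals + i * A ∧
      (P.epoch M solver εbar δbar ω k start i).jacEvals = start.jacEvals + i * B := by
  induction i with
  | zero => simp [epoch]
  | succ i ih =>
    simp only [epoch, Counted.bind, step_gEvals, step_jacEvals, ih]
    constructor <;> ring

theorem run_evals (ω : ℕ × ℕ → Draw Ξ S A B) (k : ℕ) :
    (P.run M solver εbar δbar ω x₀ τ k).gEvals = (∑ k' ∈ Finset.range k, τ k') * A ∧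
      (P.run M solver εbar δbar ω x₀ τ k).jacEvals = (∑ k' ∈ Finset.range k, τ k') * B := by
  induction k with
  | zero => simp [run, Counted.pure]
  | succ k ih =>
    simp only [run, epoch_evals, ih, Finset.sum_range_succ]
    constructor <;> ring

end Iterates

/-- A run all of whose draws are good: the squared generalized gradients are summable up to the
accumulated errors. -/
theorem Standing.sum_genGrad_le (hS : P.Standing lf lg Lg) {M c : ℝ}
    (hM : 5 * (lf : ℝ) * Lg < M)
    (hc : ∀ y, P.h y ≠ ⊤ → c ≤ P.f (P.g y) + (P.h y).toReal) {solver : Solver n S}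
    {εbar δbar tg tJ : ℝ} {A B : ℕ} {ω : ℕ × ℕ → Draw Ξ S A B} {x₀ : Vec n} (hx₀ : P.h x₀ ≠ ⊤)
    {τ : ℕ → ℕ} {K : ℕ}
    (hgood : ∀ k < K, ∀ i < τ k, P.GoodDraw M solver εbar δbar tg tJ
      (P.iterate M solver εbar δbar ω x₀ τ k i) (ω (k, i))) :
    (8 * M)⁻¹ * ∑ k ∈ Finset.range K, ∑ i ∈ Finset.range (τ k),
      ‖P.genGrad M (P.iterate M solver εbar δbar ω x₀ τ k i)‖ ^ 2 ≤
      P.f (P.g x₀) + (P.h x₀).toReal - c + (∑ k ∈ Finset.range K, τ k : ℕ) *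
        (2 * lf * tg + 3 * lf ^ 2 * tJ ^ 2 / M + εbar) := by
  set e := 2 * lf * tg + 3 * lf ^ 2 * tJ ^ 2 / M + εbar with he
  set X := P.iterate M solver εbar δbar ω x₀ τ with hX
  set F : Vec n → ℝ := fun x => P.f (P.g x) + (P.h x).toReal with hF
  -- Finiteness of `h` is carried along, since `toReal` would otherwise turn an infinite value into
  -- zero.
  have inner : ∀ k < K, P.h (X k 0) ≠ ⊤ → ∀ i ≤ τ k, P.h (X k i) ≠ ⊤ ∧
      F (X k i) + (8 * M)⁻¹ * ∑ i' ∈ Finset.range i, ‖P.genGrad M (X k i')‖ ^ 2 ≤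
        F (X k 0) + i * e := by
    intro k hk h0 i hi
    induction i with
    | zero => exact ⟨h0, by simp⟩
    | succ i ih =>
      obtain ⟨h1, h2⟩ := ih (by omega)
      obtain ⟨g1, g2, g3⟩ := hgood k hk i (by omega)
      obtain ⟨h3, h4⟩ := hS.descent hM hc h1 g1 g2 g3
      refine ⟨h3, ?_⟩
      have h5 : F (X k (i + 1)) + (8 * M)⁻¹ * ‖P.genGrad M (X k i)‖ ^ 2 ≤ F (X k i) + e := h4
      rw [Finset.sum_range_succ, mul_add]
      push_cast
      linarith
  have outer : ∀ k ≤ K, P.h (X k 0) ≠ ⊤ ∧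
      F (X k 0) + (8 * M)⁻¹ * ∑ k' ∈ Finset.range k, ∑ i ∈ Finset.range (τ k'),
        ‖P.genGrad M (X k' i)‖ ^ 2 ≤ F x₀ + (∑ k' ∈ Finset.range k, τ k' : ℕ) * e := by
    intro k hk
    induction k with
    | zero =>
      have h0 : X 0 0 = x₀ := rfl
      rw [h0]
      exact ⟨hx₀, by simp⟩
    | succ k ih =>
      obtain ⟨h1, h2⟩ := ih (by omega)
      obtain ⟨h3, h4⟩ := inner k (by omega) h1 (τ k) le_rfl
      have h0 : X (k + 1) 0 = X k (τ k) := rfl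
      rw [h0]
      refine ⟨h3, ?_⟩
      rw [Finset.sum_range_succ, Finset.sum_range_succ, mul_add]
      push_cast at h2 ⊢
      linarith
  obtain ⟨h1, h2⟩ := outer K le_rfl
  have h3 : c ≤ F (X K 0) := hc _ h1
  have h4 : F x₀ = P.f (P.g x₀) + (P.h x₀).toReal := rfl
  linarith

/-- The probability that some draw of the run is not good. -/
theorem Standing.runLaw_exists_not_goodDraw_le [MeasurableSpace S] (hS : P.Standing lf lg Lg)
    [IsProbabilityMeasure P.D] {ν : Measure S} [IsProbabilityMeasure ν] {M : ℝ}
    {solver : Solver n S} (hsol : P.SolverAssumption M ν solver) {εbar δbar : ℝ} (hε : 0 < εbar)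
    (hδ : 0 < δbar) {tg tJ : ℝ} {A B : ℕ} (x₀ : Vec n) (τ : ℕ → ℕ) (K : ℕ) {c : ℝ}
    (hbad : ∀ x, drawLaw P.D ν A B {w | ¬ P.GoodDraw M solver εbar δbar tg tJ x w} ≤
      ENNReal.ofReal c) :
    runLaw P.D ν A B {ω | ¬ ∀ k < K, ∀ i < τ k, P.GoodDraw M solver εbar δbar tg tJ
      (P.iterate M solver εbar δbar ω x₀ τ k i) (ω (k, i))} ≤
      ENNReal.ofReal ((∑ k ∈ Finset.range K, τ k : ℕ) * c) := by
  have hsub : {ω : ℕ × ℕ → Draw Ξ S A B | ¬ ∀ k < K, ∀ i < τ k,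
      P.GoodDraw M solver εbar δbar tg tJ
      (P.iterate M solver εbar δbar ω x₀ τ k i) (ω (k, i))} ⊆
      ⋃ k ∈ Finset.range K, ⋃ i ∈ Finset.range (τ k),
        {ω | ¬ P.GoodDraw M solver εbar δbar tg tJ
          (P.iterate M solver εbar δbar ω x₀ τ k i) (ω (k, i))} := by
    intro ω hω
    have hω' : ¬ ∀ k < K, ∀ i < τ k, P.GoodDraw M solver εbar δbar tg tJ
      (P.iterate M solver εbar δbar ω x₀ τ k i) (ω (k, i)) := hω
    push Not at hω'
    obtain ⟨k, hk, i, hi, hki⟩ := hω'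
    simp only [Set.mem_iUnion]
    exact ⟨k, Finset.mem_range.2 hk, i, Finset.mem_range.2 hi, hki⟩
  -- The base point is random, but it does not depend on the draw at `(k, i)` and `hbad` is uniform
  -- in it.
  have hone : ∀ k i, runLaw P.D ν A B {ω | ¬ P.GoodDraw M solver εbar δbar tg tJ
      (P.iterate M solver εbar δbar ω x₀ τ k i) (ω (k, i))} ≤ ENNReal.ofReal c := fun k i =>
    infinitePi_measure_le_of_section_le (drawLaw P.D ν A B) (k, i)
      (Y := fun ω => P.iterate M solver εbar δbar ω x₀ τ k i)
      (measurable_iterate x₀ τ (hS.measurable_step hsol hε hδ A B) k i)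
      (fun ω w => P.iterate_update M solver εbar δbar x₀ τ ω k i w)
      (hS.measurableSet_goodDraw hsol hε hδ tg tJ A B).compl hbad
  refine (measure_mono hsub).trans ((measure_biUnion_finset_le _ _).trans ?_)
  calc ∑ k ∈ Finset.range K, runLaw P.D ν A B (⋃ i ∈ Finset.range (τ k),
        {ω | ¬ P.GoodDraw M solver εbar δbar tg tJ
          (P.iterate M solver εbar δbar ω x₀ τ k i) (ω (k, i))})
      ≤ ∑ k ∈ Finset.range K, ∑ i ∈ Finset.range (τ k), ENNReal.ofReal c :=
        Finset.sum_le_sum fun k _ => (measure_biUnion_finset_le _ _).trans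
          (Finset.sum_le_sum fun i _ => hone k i)
    _ = ENNReal.ofReal ((∑ k ∈ Finset.range K, τ k : ℕ) * c) := by
        simp only [Finset.sum_const, Finset.card_range, nsmul_eq_mul]
        rw [← Finset.sum_mul, ENNReal.ofReal_mul (by positivity), ENNReal.ofReal_natCast]
        push_cast
        rfl

end Problem

/-! ### Parameter choices -/

theorem one_le_log_div {d T Δ : ℝ} (hd : 1 ≤ d) (hT : 1 ≤ T) (hΔ : 0 < Δ) (hΔ1 : Δ < 1) :
    1 ≤ Real.log (4 * d * T / Δ) := by
  have h1 : 4 ≤ 4 * d * T / Δ := by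
    rw [le_div_iff₀ hΔ]
    nlinarith
  rw [Real.le_log_iff_exp_le (by linarith)]
  linarith [Real.exp_one_lt_d9]

theorem mul_exp_neg_ceil_log_le {d T Δ : ℝ} (hd : 1 ≤ d) (hT : 1 ≤ T) (hΔ : 0 < Δ) :
    d * Real.exp (-(⌈Real.log (4 * d * T / Δ)⌉₊ : ℝ)) ≤ Δ / (4 * T) := by
  have hpos : 0 < 4 * d * T / Δ := by positivity
  calc d * Real.exp (-(⌈Real.log (4 * d * T / Δ)⌉₊ : ℝ))
      ≤ d * Real.exp (-Real.log (4 * d * T / Δ)) := by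
        gcongr
        exact Nat.le_ceil _
    _ = Δ / (4 * T) := by
        rw [Real.exp_neg, Real.exp_log hpos]
        field_simp

/-- The tail exponent is `p = ⌈L⌉`; rounding at most doubles `L ≥ 1`, which turns the constant 4
into 8. -/
theorem batch_size_sufficient {C σ t r L : ℝ} (hL : 1 ≤ L)
    (hC : 8 * Real.exp 3 * σ ^ 2 ≤ C * r * t ^ 2) :
    4 * Real.exp 3 * (⌈L⌉₊ : ℝ) * σ ^ 2 ≤ (⌈C * r * L⌉₊ : ℝ) * t ^ 2 := by
  have h1 : (⌈L⌉₊ : ℝ) ≤ 2 * L := by linarith [Nat.ceil_lt_add_one (by linarith : 0 ≤ L)]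
  calc 4 * Real.exp 3 * (⌈L⌉₊ : ℝ) * σ ^ 2 ≤ 4 * Real.exp 3 * (2 * L) * σ ^ 2 := by gcongr
    _ = (8 * Real.exp 3 * σ ^ 2) * L := by ring
    _ ≤ (C * r * t ^ 2) * L := by gcongr
    _ = (C * r * L) * t ^ 2 := by ring
    _ ≤ (⌈C * r * L⌉₊ : ℝ) * t ^ 2 := by gcongr; exact Nat.le_ceil _

/-- Here `r` is `ε⁻²` or `ε⁻¹`. The logarithm in the batch size is a sum of `log (1/ε)`, `log (1/Δ)`
and a constant, to be bounded by a product; this needs `log (1/ε) ≥ 1` and `log (1/Δ)` bounded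
below, hence `Δ₀`. -/
theorem exists_eval_bounds {Cτ C₁ d Δ₀ : ℝ} (hCτ : 0 < Cτ) (hC₁ : 0 < C₁) (hd : 1 ≤ d)
    (hΔ₀ : 0 < Δ₀) (hΔ₀1 : Δ₀ < 1) : ∃ c > (0 : ℝ), ∃ C > (0 : ℝ), ∀ (Δ ε r : ℝ) (T N : ℕ),
      0 < Δ → Δ ≤ Δ₀ → 0 < ε → ε ≤ Cτ → ε ≤ Real.exp (-1) → 1 ≤ r → T = ⌈Cτ * ε⁻¹⌉₊ →
      N = ⌈C₁ * r * Real.log (4 * d * T / Δ)⌉₊ →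
      c * (ε⁻¹ * r) * Real.log (1 / Δ) ≤ (T : ℝ) * N ∧
        (T : ℝ) * N ≤ C * (ε⁻¹ * r) * Real.log (1 / ε) * Real.log (1 / Δ) := by
  have hl₀ : 0 < Real.log (1 / Δ₀) := Real.log_pos (by rw [lt_div_iff₀ hΔ₀]; linarith)
  set l₀ := Real.log (1 / Δ₀) with hl₀def
  set a := |Real.log (8 * d * Cτ)| with ha
  -- One summand for each of the constant, `log (1/ε)` and `log (1/Δ)`.
  set q := a / l₀ + 1 / l₀ + 1 with hq
  have hq0 : 0 < q := by positivity
  refine ⟨Cτ * C₁, by positivity, 2 * Cτ * (C₁ + 1) * q, by positivity, ?_⟩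
  intro Δ ε r T N hΔ hΔΔ₀ hε hεC hεe hr hT hN
  have hCε : 1 ≤ Cτ * ε⁻¹ := by
    rw [← div_eq_mul_inv, le_div_iff₀ hε]; linarith
  have hTlow : Cτ * ε⁻¹ ≤ T := by rw [hT]; exact Nat.le_ceil _
  have hT1 : (1 : ℝ) ≤ T := hCε.trans hTlow
  have hTup : (T : ℝ) ≤ 2 * Cτ * ε⁻¹ := by
    have h1 := Nat.ceil_lt_add_one (by positivity : 0 ≤ Cτ * ε⁻¹)
    rw [← hT] at h1
    linarith
  have hL1 := one_le_log_div hd hT1 hΔ (by linarith)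
  set L := Real.log (4 * d * T / Δ) with hL
  have hNlow : C₁ * r * L ≤ N := by rw [hN]; exact Nat.le_ceil _
  have hNup : (N : ℝ) ≤ (C₁ + 1) * r * L := by
    have h1 := Nat.ceil_lt_add_one (by positivity : 0 ≤ C₁ * r * L)
    rw [← hN] at h1
    nlinarith
  have hlΔ : l₀ ≤ Real.log (1 / Δ) := Real.log_le_log (by positivity) (by gcongr)
  have hlε : 1 ≤ Real.log (1 / ε) := by
    rw [one_div, Real.log_inv]
    have := Real.log_le_log hε hεe
    rw [Real.log_exp] at this
    linarith
  have hLlow : Real.log (1 / Δ) ≤ L := by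
    refine Real.log_le_log (by positivity) ?_
    gcongr
    nlinarith
  have hLup : L ≤ q * (Real.log (1 / ε) * Real.log (1 / Δ)) := by
    have h1 : L ≤ Real.log (8 * d * Cτ) + Real.log (1 / ε) + Real.log (1 / Δ) := by
      rw [← Real.log_mul (by positivity) (by positivity),
        ← Real.log_mul (by positivity) (by positivity)]
      refine Real.log_le_log (by positivity) ?_
      calc 4 * d * T / Δ ≤ 4 * d * (2 * Cτ * ε⁻¹) / Δ := by gcongr
        _ = 8 * d * Cτ * (1 / ε) * (1 / Δ) := by field_simp; ring
    set u := Real.log (1 / ε)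
    set v := Real.log (1 / Δ)
    have hv0 : 0 < v := hl₀.trans_le hlΔ
    have h2 : 1 ≤ v / l₀ := by rwa [le_div_iff₀ hl₀, one_mul]
    have h3 : Real.log (8 * d * Cτ) ≤ a * (u * (v / l₀)) := by
      refine (le_abs_self _).trans ?_
      have : 1 ≤ u * (v / l₀) := by nlinarith
      exact le_mul_of_one_le_right (abs_nonneg _) this
    have h4 : u ≤ u * (v / l₀) := le_mul_of_one_le_right (by linarith) h2
    have h5 : v ≤ u * v := le_mul_of_one_le_left hv0.le hlε
    have h6 : q * (u * v) = a * (u * (v / l₀)) + u * (v / l₀) + u * v := by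
      rw [hq]; field_simp
    linarith
  constructor
  · calc Cτ * C₁ * (ε⁻¹ * r) * Real.log (1 / Δ) = (Cτ * ε⁻¹) * (C₁ * r * Real.log (1 / Δ)) := by
          ring
      _ ≤ (Cτ * ε⁻¹) * (C₁ * r * L) := by gcongr
      _ ≤ T * N := by gcongr
  · calc (T : ℝ) * N ≤ (2 * Cτ * ε⁻¹) * ((C₁ + 1) * r * L) := by gcongr
      _ ≤ (2 * Cτ * ε⁻¹) * ((C₁ + 1) * r * (q * (Real.log (1 / ε) * Real.log (1 / Δ)))) := by
          gcongr
      _ = _ := by ring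

/-- The final accounting of the error terms. -/
theorem average_le_of_sum_le {M l gap ε εbar tg tJ Q T : ℝ} (hM : 0 < M) (hl : 0 ≤ l) (hε : 0 < ε)
    (htg : tg = ε / (64 * M * (l + 1))) (htJ : tJ ^ 2 = ε / (96 * (l + 1) ^ 2))
    (hεbar : εbar ≤ ε / (5 * 30 * M)) (hT : 32 * M * (|gap| + 1) * ε⁻¹ ≤ T)
    (hQ : (8 * M)⁻¹ * Q ≤ gap + T * (2 * l * tg + 3 * l ^ 2 * tJ ^ 2 / M + εbar)) :
    1 / T * Q ≤ ε := by
  have hT0 : 0 < T := lt_of_lt_of_le (by positivity) hT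
  have hQ' : Q ≤ 8 * M * gap + T * (16 * M * l * tg + 24 * l ^ 2 * tJ ^ 2 + 8 * M * εbar) := by
    have h1 : 8 * M * ((8 * M)⁻¹ * Q) ≤
        8 * M * (gap + T * (2 * l * tg + 3 * l ^ 2 * tJ ^ 2 / M + εbar)) := by gcongr
    have h2 : 8 * M * ((8 * M)⁻¹ * Q) = Q := by field_simp
    rw [h2] at h1
    refine h1.trans (le_of_eq ?_)
    field_simp
    ring
  -- The value error, Jacobian error, solver error and initial gap each get a quarter of `ε`. The
  -- tolerances contain `l + 1` so that `l = 0` is allowed.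
  have h1 : 16 * M * l * tg ≤ ε / 4 := by
    rw [htg]
    have : 16 * M * l * (ε / (64 * M * (l + 1))) = ε / 4 * (l / (l + 1)) := by field_simp; ring
    rw [this]
    exact mul_le_of_le_one_right (by positivity) ((div_le_one (by positivity)).2 (by linarith))
  have h2 : 24 * l ^ 2 * tJ ^ 2 ≤ ε / 4 := by
    rw [htJ]
    have : 24 * l ^ 2 * (ε / (96 * (l + 1) ^ 2)) = ε / 4 * (l / (l + 1)) ^ 2 := by field_simp; ring
    rw [this]
    refine mul_le_of_le_one_right (by positivity) (pow_le_one₀ (by positivity) ?_)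
    exact (div_le_one (by positivity)).2 (by linarith)
  have h3 : 8 * M * εbar ≤ ε / 4 := by
    have h4 : 8 * M * εbar ≤ 8 * M * (ε / (5 * 30 * M)) := by gcongr
    have h5 : 8 * M * (ε / (5 * 30 * M)) = 4 / 75 * ε := by field_simp; norm_num
    linarith
  have h4 : 8 * M * gap ≤ T * (ε / 4) := by
    have h5 : 32 * M * (|gap| + 1) * ε⁻¹ * (ε / 4) ≤ T * (ε / 4) := by gcongr
    have h6 : 32 * M * (|gap| + 1) * ε⁻¹ * (ε / 4) = 8 * M * (|gap| + 1) := by field_simp; norm_num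
    have h7 : 8 * M * gap ≤ 8 * M * (|gap| + 1) := by
      gcongr
      linarith [le_abs_self gap]
    linarith
  rw [one_div_mul_eq_div, div_le_iff₀ hT0]
  have h5 : T * (16 * M * l * tg + 24 * l ^ 2 * tJ ^ 2 + 8 * M * εbar) ≤
      T * (ε / 4 + ε / 4 + ε / 4) := by gcongr
  linarith

theorem corollary1 (M gap σg σJ : ℝ) (lf Lg : ℝ≥0) (hM : 5 * (lf : ℝ) * (Lg : ℝ) < M) :
    -- the constants of the parameter choices, and how small `ε` has to be
    ∃ Cτ > (0 : ℝ), ∃ CA > (0 : ℝ), ∃ CB > (0 : ℝ), ∃ ε₀ > (0 : ℝ),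
    ∀ n m : ℕ, 0 < m + n → ∀ Δ₀ : ℝ, 0 < Δ₀ → Δ₀ < 1 →
    -- the constants hidden in the complexity bounds
    ∃ c > (0 : ℝ), ∃ C > (0 : ℝ),
    ∀ (Ξ : Type*) [MeasurableSpace Ξ] (P : Problem n m Ξ) [IsProbabilityMeasure P.D]
      (lg : ℝ≥0) (x₀ : Vec n),
      P.Standing lf lg Lg → P.UniformVariance σg σJ →
      ⊥ < (⨅ x, P.Φ x) → P.Φ x₀ ≤ (⨅ x, P.Φ x) + (gap : EReal) →
    ∀ (S : Type*) [MeasurableSpace S] (ν : Measure S) [IsProbabilityMeasure ν]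
      (solver : Solver n S), P.SolverAssumption M ν solver →
    ∀ Δ : ℝ, 0 < Δ → Δ ≤ Δ₀ → ∀ ε : ℝ, 0 < ε → ε ≤ ε₀ →
    ∀ (K : ℕ) (τ : ℕ → ℕ) (T A B : ℕ) (εbar δbar : ℝ),
      (∀ k < K, 0 < τ k) → ∑ k ∈ Finset.range K, τ k = T →
      T = ⌈Cτ * ε⁻¹⌉₊ →
      A = ⌈CA * (ε ^ 2)⁻¹ * Real.log (4 * (m + 1) * T / Δ)⌉₊ →
      B = ⌈CB * ε⁻¹ * Real.log (4 * (m + n) * T / Δ)⌉₊ →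
      0 < δbar → δbar ≤ Δ / (2 * T) → 0 < εbar → εbar ≤ ε / (5 * 30 * M) →
      ENNReal.ofReal (1 - Δ) ≤ runLaw P.D ν A B {ω |
        -- (i) the average squared generalized gradient
        1 / (T : ℝ) * ∑ k ∈ Finset.range K, ∑ i ∈ Finset.range (τ k),
          ‖P.genGrad M (P.iterate M solver εbar δbar ω x₀ τ k i)‖ ^ 2 ≤ ε ∧
        -- (ii) the numbers of evaluations of `g_ξ` and of `g'_ξ`
        c * (ε ^ 3)⁻¹ * Real.log (1 / Δ) ≤ (P.run M solver εbar δbar ω x₀ τ K).gEvals ∧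
        (P.run M solver εbar δbar ω x₀ τ K).gEvals ≤
          C * (ε ^ 3)⁻¹ * Real.log (1 / ε) * Real.log (1 / Δ) ∧
        c * (ε ^ 2)⁻¹ * Real.log (1 / Δ) ≤ (P.run M solver εbar δbar ω x₀ τ K).jacEvals ∧
        (P.run M solver εbar δbar ω x₀ τ K).jacEvals ≤
          C * (ε ^ 2)⁻¹ * Real.log (1 / ε) * Real.log (1 / Δ)} := by
  have hlL : 0 ≤ (lf : ℝ) * Lg := by positivity
  have hM0 : 0 < M := by linarith
  have hl1 : 0 < (lf : ℝ) + 1 := by positivity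
  set sg := |σg| + 1 with hsg
  set sJ := |σJ| + 1 with hsJ
  have hsg0 : 0 < sg := by positivity
  have hsJ0 : 0 < sJ := by positivity
  set Cτ := 32 * M * (|gap| + 1) with hCτ
  -- `CA` and `CB` are solved from `CA ε⁻² tg² = 8 e³ sg²` and `CB ε⁻¹ tJ² = 8 e³ sJ²`, with the
  -- tolerances chosen below.
  set CA := 8 * Real.exp 3 * sg ^ 2 * (64 * M * (lf + 1)) ^ 2 with hCA
  set CB := 8 * Real.exp 3 * sJ ^ 2 * (96 * (lf + 1) ^ 2) with hCB
  have hCτ0 : 0 < Cτ := by positivity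
  have hCA0 : 0 < CA := by positivity
  have hCB0 : 0 < CB := by positivity
  -- `ε ≤ Cτ` ensures that rounding at most doubles `Cτ / ε`; `ε ≤ exp(-1)` ensures `log (1/ε) ≥ 1`.
  refine ⟨Cτ, hCτ0, CA, hCA0, CB, hCB0, min Cτ (Real.exp (-1)),
    lt_min hCτ0 (Real.exp_pos _), ?_⟩
  intro n m hmn Δ₀ hΔ₀ hΔ₀1
  have hdA : (1 : ℝ) ≤ m + 1 := by linarith [(Nat.cast_nonneg m : (0 : ℝ) ≤ m)]
  have hdB : (1 : ℝ) ≤ m + n := by exact_mod_cast hmn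
  obtain ⟨c₁, hc₁, C₁, hC₁, hbA⟩ := exists_eval_bounds hCτ0 hCA0 hdA hΔ₀ hΔ₀1
  obtain ⟨c₂, hc₂, C₂, hC₂, hbB⟩ := exists_eval_bounds hCτ0 hCB0 hdB hΔ₀ hΔ₀1
  refine ⟨min c₁ c₂, lt_min hc₁ hc₂, max C₁ C₂, lt_max_of_lt_left hC₁, ?_⟩
  intro Ξ _ P _ lg x₀ hS hV hbot hgap S _ ν _ solver hsol Δ hΔ hΔΔ₀ ε hε hεε₀ K τ T A B εbar δbar
    _ hsum hT hA hB hδ hδT hεbar hεbarε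
  have hΔ1 : Δ < 1 := by linarith
  have hεC : ε ≤ Cτ := hεε₀.trans (min_le_left _ _)
  have hεe : ε ≤ Real.exp (-1) := hεε₀.trans (min_le_right _ _)
  have hε1 : ε ≤ 1 := hεe.trans (Real.exp_le_one_iff.2 (by norm_num))
  have hTlow : Cτ * ε⁻¹ ≤ T := by rw [hT]; exact Nat.le_ceil _
  have hT1 : (1 : ℝ) ≤ T := by
    refine le_trans ?_ hTlow
    rw [← div_eq_mul_inv, le_div_iff₀ hε]
    linarith
  have hT0 : (0 : ℝ) < T := by linarith
  -- the objective at the start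
  obtain ⟨z, hz⟩ := hS.proper_h
  set c := (⨅ x, P.Φ x).toReal with hc
  have hinf : (⨅ x, P.Φ x) = (c : EReal) := by
    refine (EReal.coe_toReal (ne_of_lt ?_) hbot.ne').symm
    refine (iInf_le _ z).trans_lt ?_
    rw [hS.Φ_eq_coe hz]
    exact EReal.coe_lt_top _
  have hcle : ∀ y, P.h y ≠ ⊤ → c ≤ P.f (P.g y) + (P.h y).toReal := by
    intro y hy
    have h := iInf_le P.Φ y
    rwa [hinf, hS.Φ_eq_coe hy, EReal.coe_le_coe_iff] at h
  rw [hinf, ← EReal.coe_add] at hgap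
  have hx₀ : P.h x₀ ≠ ⊤ := by
    intro h
    have h1 : P.Φ x₀ = ⊤ := by rw [Problem.Φ, h, EReal.coe_add_top]
    rw [h1] at hgap
    exact EReal.coe_ne_top _ (top_le_iff.1 hgap)
  rw [hS.Φ_eq_coe hx₀, EReal.coe_le_coe_iff] at hgap
  -- accuracy of the estimators
  set tg := ε / (64 * M * (lf + 1)) with htg
  set tJ := Real.sqrt (ε / (96 * ((lf : ℝ) + 1) ^ 2)) with htJ
  have htg0 : 0 < tg := by positivity
  have htJ0 : 0 < tJ := Real.sqrt_pos.2 (by positivity)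
  have htJ2 : tJ ^ 2 = ε / (96 * ((lf : ℝ) + 1) ^ 2) := Real.sq_sqrt (by positivity)
  have hLA := one_le_log_div hdA hT1 hΔ hΔ1
  have hLB := one_le_log_div hdB hT1 hΔ hΔ1
  have hA0 : 0 < A := by rw [hA]; exact Nat.ceil_pos.2 (by positivity)
  have hB0 : 0 < B := by rw [hB]; exact Nat.ceil_pos.2 (by positivity)
  have hAsuff : 4 * Real.exp 3 * (⌈Real.log (4 * (m + 1) * T / Δ)⌉₊ : ℝ) * sg ^ 2 ≤
      A * tg ^ 2 := by
    rw [hA]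
    refine batch_size_sufficient hLA (le_of_eq ?_)
    rw [hCA, htg]
    field_simp
  have hBsuff : 4 * Real.exp 3 * (⌈Real.log (4 * (m + n) * T / Δ)⌉₊ : ℝ) * sJ ^ 2 ≤
      B * tJ ^ 2 := by
    rw [hB]
    refine batch_size_sufficient hLB (le_of_eq ?_)
    rw [hCB, htJ2]
    field_simp
  have hbad : ∀ x, drawLaw P.D ν A B {w | ¬ P.GoodDraw M solver εbar δbar tg tJ x w} ≤
      ENNReal.ofReal (Δ / (4 * T) + Δ / (4 * T) + δbar) := fun x =>
    hS.drawLaw_not_goodDraw_le hsol hεbar hδ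
      ((hS.measure_g_batch_gt_le hV hsg0 ((le_abs_self _).trans (by linarith)) x
        (Nat.ceil_pos.2 (by linarith)) hA0 htg0 hAsuff).trans
        (mul_exp_neg_ceil_log_le hdA hT1 hΔ))
      ((hS.measure_jac_batch_gt_le hV hsJ0 ((le_abs_self _).trans (by linarith)) x
        (Nat.ceil_pos.2 (by linarith)) hB0 htJ0 hBsuff).trans
        (mul_exp_neg_ceil_log_le hdB hT1 hΔ))
  have hfail := hS.runLaw_exists_not_goodDraw_le hsol hεbar hδ x₀ τ K hbad
  -- Half of `Δ` is spent on the two kinds of batches, half on the solver.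
  have hfail' : ((∑ k ∈ Finset.range K, τ k : ℕ) : ℝ) * (Δ / (4 * T) + Δ / (4 * T) + δbar) ≤ Δ := by
    rw [hsum]
    calc (T : ℝ) * (Δ / (4 * T) + Δ / (4 * T) + δbar)
        ≤ T * (Δ / (4 * T) + Δ / (4 * T) + Δ / (2 * T)) := by gcongr
      _ = Δ := by field_simp; ring
  have hfail'' := hfail.trans (ENNReal.ofReal_le_ofReal hfail')
  have : IsProbabilityMeasure (runLaw P.D ν A B) := by unfold runLaw; infer_instance
  rw [ENNReal.ofReal_sub _ hΔ.le, ENNReal.ofReal_one, tsub_le_iff_right]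
  refine le_trans ?_ (add_le_add le_rfl hfail'')
  rw [← measure_univ (μ := runLaw P.D ν A B)]
  -- The whole space is covered by the claimed event and the bad one, so the claimed event need not
  -- be shown measurable.
  refine le_trans (measure_mono fun ω _ => ?_) (measure_union_le _ _)
  by_cases hω : ∀ k < K, ∀ i < τ k, P.GoodDraw M solver εbar δbar tg tJ
      (P.iterate M solver εbar δbar ω x₀ τ k i) (ω (k, i))
  swap
  · exact Or.inr hω
  refine Or.inl ⟨?_, ?_⟩
  · have hQ := hS.sum_genGrad_le hM hcle hx₀ hω
    rw [hsum] at hQ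
    exact average_le_of_sum_le hM0 lf.coe_nonneg hε htg htJ2 hεbarε hTlow
      (hQ.trans (by linarith))
  · obtain ⟨hNg, hNJ⟩ := P.run_evals M solver εbar δbar x₀ τ ω K
    rw [hNg, hNJ, hsum]
    have hr1 : 1 ≤ ε⁻¹ := (one_le_inv₀ hε).2 hε1
    have hr2 : 1 ≤ (ε ^ 2)⁻¹ := (one_le_inv₀ (by positivity)).2 (pow_le_one₀ hε.le hε1)
    obtain ⟨a1, a2⟩ := hbA Δ ε (ε ^ 2)⁻¹ T A hΔ hΔΔ₀ hε hεC hεe hr2 hT hA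
    obtain ⟨b1, b2⟩ := hbB Δ ε ε⁻¹ T B hΔ hΔΔ₀ hε hεC hεe hr1 hT hB
    have e3 : ε⁻¹ * (ε ^ 2)⁻¹ = (ε ^ 3)⁻¹ := by rw [← mul_inv]; congr 1; ring
    have e2 : ε⁻¹ * ε⁻¹ = (ε ^ 2)⁻¹ := by rw [← mul_inv]; congr 1; ring
    rw [e3] at a1 a2
    rw [e2] at b1 b2
    have hlΔ : 0 ≤ Real.log (1 / Δ) := Real.log_nonneg (by rw [le_div_iff₀ hΔ]; linarith)
    have hlε : 0 ≤ Real.log (1 / ε) := Real.log_nonneg (by rw [le_div_iff₀ hε]; linarith)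
    push_cast
    refine ⟨le_trans ?_ a1, a2.trans ?_, le_trans ?_ b1, b2.trans ?_⟩
    · gcongr; exact min_le_left _ _
    · gcongr; exact le_max_left _ _
    · gcongr; exact min_le_right _ _
    · gcongr; exact le_max_right _ _
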